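/- Let $S$ be a finite ground set with $n=|S|$, $\mathcal F\subseteq 2^S$ a family of feasible solutions, $F^*\in\mathcal F$ an input solution, $c\in\mathbb R^S$ a cost function, $w\in\mathbb R_{>0}^S$ a positive weight function such that $1/w(s)$ is an integer for every $s\in S$, and $\ell\colon S\to\mathbb R\cup\{-\infty\}$, $u\colon S\to\mathbb R\cup\{+\infty\}$ bounds with $\ell\le u$. Put $\|w\|_{-1}=\sum_{s\in S}1/w(s)$. A vector $p\in\mathbb R^S$ is a feasible deviation vector if $\ell\le p\le u$ and $F^*$ is a minimum-cost member of $\mathcal F$ with respect to the cost function $c-p$. It is an optimal deviation vector if, in addition, it minimizes the weighted span $\max_{s\in S} w(s)p(s)-\min_{s\in S} w(s)p(s)$ among all feasible deviation vectors. The family $\mathcal F$ is accessible only through an oracle $\mathcal O$ that returns, for any cost function $c'\in\mathbb R^S$, a minimum-cost member of $\mathcal F$ with respect to $c'$. Then there exists an algorithm (a single program for a real random access machine with exact arithmetic and comparisons, which receives $n,F^*,c,w,\ell,u$ as input and may call $\mathcal O$) that, for every such instance and every such oracle, halts after $O(n^2\cdot\|w\|_{-1}^6)$ calls to $\mathcal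 O$, where the implied constant is absolute, and that outputs an optimal deviation vector if a feasible deviation vector exists, and reports that the problem is infeasible otherwise. -/

import Mathlib

/-! Minimum-cost inverse optimization under the weighted span objective, and while-programs on a
real random access machine that may call an optimization oracle. -/

namespace InvSpan

noncomputable section

/-- A bound-constrained minimum-cost inverse optimization problem `(S, 𝓕, F*, c, ℓ, u, span_w)` on
the ground set `S = {0, …, n - 1}`. The bounds take values in `ℝ ∪ {-∞}` and `ℝ ∪ {+∞}`; the weights
are positive and scaled so that every `1 / w s` is an integer. -/
structure Problem (n : ℕ) where
  feas : Set (Finset (Fin n))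
  Fstar : Finset (Fin n)
  Fstar_mem : Fstar ∈ feas
  c : Fin n → ℝ
  lower : Fin n → EReal
  upper : Fin n → EReal
  lower_ne_top : ∀ s, lower s ≠ ⊤
  upper_ne_bot : ∀ s, upper s ≠ ⊥
  lower_le_upper : ∀ s, lower s ≤ upper s
  w : Fin n → ℝ
  w_pos : ∀ s, 0 < w s
  inv_w_integral : ∀ s, ∃ k : ℕ, 1 / w s = (k : ℝ)

/-- The weighted span `max_s w(s) p(s) - min_s w(s) p(s)` (`0` on an empty ground set). -/
def wspan {n : ℕ} (w p : Fin n → ℝ) : ℝ :=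
  (⨆ s, w s * p s) - ⨅ s, w s * p s

/-- `F` is a minimum-cost member of `𝓕` with respect to the cost function `c`. -/
def IsMinCost {n : ℕ} (feas : Set (Finset (Fin n))) (c : Fin n → ℝ) (F : Finset (Fin n)) : Prop :=
  F ∈ feas ∧ ∀ G ∈ feas, ∑ s ∈ F, c s ≤ ∑ s ∈ G, c s

/-- `O` is an optimization oracle for `𝓕`: on every cost function it returns a minimum-cost member. -/
def IsOracle {n : ℕ} (feas : Set (Finset (Fin n))) (O : (Fin n → ℝ) → Finset (Fin n)) : Prop :=
  ∀ c, IsMinCost feas c (O c)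

namespace Problem

variable {n : ℕ} (I : Problem n)

/-- Feasible deviation vectors. -/
def IsFeasible (p : Fin n → ℝ) : Prop :=
  IsMinCost I.feas (fun s => I.c s - p s) I.Fstar ∧
    ∀ s, I.lower s ≤ (p s : EReal) ∧ (p s : EReal) ≤ I.upper s

/-- Optimal deviation vectors: feasible ones of minimum weighted span. -/
def IsOptimal (p : Fin n → ℝ) : Prop :=
  I.IsFeasible p ∧ ∀ q, I.IsFeasible q → wspan I.w p ≤ wspan I.w q

/-- `‖w‖₋₁`, the sum of the reciprocals of the weights. -/
def invNorm : ℝ := ∑ s, 1 / I.w s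

end Problem

/-- Machine states. The memory consists of arrays of natural numbers and arrays of real numbers:
`nat a i` and `real a i` are the `i`-th entries of the arrays with name `a`. The field `calls` counts
the oracle calls made so far; programs cannot access it. -/
structure State where
  nat : ℕ → ℕ → ℕ
  real : ℕ → ℕ → ℝ
  calls : ℕ

/-- Natural number expressions; `get a i` reads entry `i` of the natural array `a`. -/
inductive NExp where
  | const (k : ℕ)
  | get (a : ℕ) (i : NExp)
  | add (x y : NExp)
  | sub (x y : NExp)
  | mul (x y : NExp)

/-- Real expressions; `get a i` reads entry `i` of the real array `a`. -/
inductive RExp where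
  | ofNat (x : NExp)
  | get (a : ℕ) (i : NExp)
  | add (x y : RExp)
  | sub (x y : RExp)
  | mul (x y : RExp)
  | div (x y : RExp)

/-- Boolean expressions. -/
inductive BExp where
  | natLe (x y : NExp)
  | realLe (x y : RExp)
  | not (b : BExp)
  | and (b b' : BExp)

/-- Programs. `setNat a i x` and `setReal a i x` store the value of `x` in entry `i` of array `a`;
`oracle a b` calls the oracle on the cost function held by the real array `a` and stores the
characteristic vector of its answer in the natural array `b`. -/
inductive Prog where
  | skip
  | setNat (a : ℕ) (i : NExp) (x : NExp)
  | setReal (a : ℕ) (i : NExp) (x : RExp)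
  | oracle (a b : ℕ)
  | seq (P Q : Prog)
  | ite (b : BExp) (P Q : Prog)
  | loop (b : BExp) (P : Prog)

/-- Value of a natural number expression (subtraction is truncated). -/
def NExp.eval (σ : State) : NExp → ℕ
  | const k => k
  | get a i => σ.nat a (i.eval σ)
  | add x y => x.eval σ + y.eval σ
  | sub x y => x.eval σ - y.eval σ
  | mul x y => x.eval σ * y.eval σ

/-- Value of a real expression, in exact arithmetic (with `x / 0 = 0`). -/
def RExp.eval (σ : State) : RExp → ℝ
  | ofNat x => (x.eval σ : ℝ)
  | get a i => σ.real a (i.eval σ)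
  | add x y => x.eval σ + y.eval σ
  | sub x y => x.eval σ - y.eval σ
  | mul x y => x.eval σ * y.eval σ
  | div x y => x.eval σ / y.eval σ

/-- Truth of a Boolean expression. -/
def BExp.Holds (σ : State) : BExp → Prop
  | natLe x y => x.eval σ ≤ y.eval σ
  | realLe x y => x.eval σ ≤ y.eval σ
  | not b => ¬ b.Holds σ
  | and b b' => b.Holds σ ∧ b'.Holds σ

/-- The characteristic vector of a subset of `{0, …, n - 1}`, followed by zeros. -/
def charVec {n : ℕ} (F : Finset (Fin n)) (i : ℕ) : ℕ :=
  if ∃ s ∈ F, (s : ℕ) = i then 1 else 0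

/-- The vector `(x s)_{s < n}`, followed by zeros. -/
def extend {n : ℕ} (x : Fin n → ℝ) (i : ℕ) : ℝ :=
  if h : i < n then x ⟨i, h⟩ else 0

/-- `Exec O P σ τ`: with the oracle `O`, the program `P` started in state `σ` halts in state `τ`. -/
inductive Exec {n : ℕ} (O : (Fin n → ℝ) → Finset (Fin n)) : Prog → State → State → Prop
  | skip (σ : State) : Exec O .skip σ σ
  | setNat (σ : State) (a : ℕ) (i x : NExp) :
      Exec O (.setNat a i x) σ
        ⟨Function.update σ.nat a (Function.update (σ.nat a) (i.eval σ) (x.eval σ)),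
          σ.real, σ.calls⟩
  | setReal (σ : State) (a : ℕ) (i : NExp) (x : RExp) :
      Exec O (.setReal a i x) σ
        ⟨σ.nat, Function.update σ.real a (Function.update (σ.real a) (i.eval σ) (x.eval σ)),
          σ.calls⟩
  | oracle (σ : State) (a b : ℕ) :
      Exec O (.oracle a b) σ
        ⟨Function.update σ.nat b (charVec (O fun s => σ.real a s)), σ.real, σ.calls + 1⟩
  | seq {P Q : Prog} {σ τ ρ : State} : Exec O P σ τ → Exec O Q τ ρ → Exec O (.seq P Q) σ ρ
  | ite_true {b : BExp} {P Q : Prog} {σ τ : State} :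
      b.Holds σ → Exec O P σ τ → Exec O (.ite b P Q) σ τ
  | ite_false {b : BExp} {P Q : Prog} {σ τ : State} :
      ¬ b.Holds σ → Exec O Q σ τ → Exec O (.ite b P Q) σ τ
  | loop_done {b : BExp} {P : Prog} {σ : State} : ¬ b.Holds σ → Exec O (.loop b P) σ σ
  | loop_step {b : BExp} {P : Prog} {σ τ ρ : State} :
      b.Holds σ → Exec O P σ τ → Exec O (.loop b P) τ ρ → Exec O (.loop b P) σ ρ

open Classical in
/-- The initial state. Natural arrays `0`–`3`: the number `n` (in entry `0`), the characteristic
vectors of `F*`, of `{s | ℓ(s) = -∞}` and of `{s | u(s) = +∞}`. Real arrays `0`–`3`: `c`, `w`, and the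
finite values of `ℓ` and `u` (`0` for an infinite value). Everything else is `0`. The family `𝓕` is
not part of the input: it is accessible only through the oracle. -/
def Problem.input {n : ℕ} (I : Problem n) : State where
  nat a i := match a with
    | 0 => if i = 0 then n else 0
    | 1 => charVec I.Fstar i
    | 2 => charVec {s : Fin n | I.lower s = ⊥} i
    | 3 => charVec {s : Fin n | I.upper s = ⊤} i
    | _ => 0
  real a i := match a with
    | 0 => extend I.c i
    | 1 => extend I.w i
    | 2 => extend (fun s => (I.lower s).toReal) i
    | 3 => extend (fun s => (I.upper s).toReal) i
    | _ => 0
  calls := 0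

/-- A final state says `infeasible` when entry `0` of the natural array `4` is `0`. -/
def State.SaysInfeasible (σ : State) : Prop := σ.nat 4 0 = 0

/-- The vector that a final state outputs, in the real array `4`. -/
def State.output (n : ℕ) (σ : State) : Fin n → ℝ := fun s => σ.real 4 s

end

end InvSpan

/-! Among the vectors that obey the bounds and have all weighted entries in `[a, b]`, `dev a b`
favours `F*` most: it is as large as possible on `F*` and as small as possible elsewhere. So it
suffices to find a pair with `b - a` minimal for which `dev a b` is feasible. The advantage that
`dev a b` gives `F*` over a member `G` is concave and piecewise linear in `(a, b)`. Each of its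
linearizations yields a half-plane `Γ ≤ X * b - Y * a` with `X, Y ≥ 0`, valid for every feasible
deviation vector (`valid_cut`).

The program is a cutting plane method in this plane, started with the half-planes given by the
bounds. It keeps the minimum `d` of `b - a` over the half-planes collected so far. On the line `b -
a = d` a half-plane with `X ≠ Y` is a ray in `a`, and pairwise compatible rays have a common point;
hence `d` need only account for single half-planes and pairs, and a suitable `a` is found greedily
(`Good.correct`). The oracle is called on the cost reduced by `dev a b`. If its answer `G` gives no
violated cut, then `F*` is a minimum too and `dev a b` is optimal, because `d` bounds every span
from below (`isOptimal_dev`). Otherwise the cut is added. Half-planes with a positive coefficient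
all contain the points with `a` very negative and `b` very large, so infeasibility shows only as a
cut with `X = Y = 0 < Γ`.

For the number of calls, each cut gets a key: how many elements are clipped at their upper and at
their lower bound, and the integers `X` and `Y`. Clipped sets are nested, so equal keys mean equal
linear parts; among cuts of one key, that of a minimum-cost member has the largest constant. A
violated cut therefore has a new key (`key_notMem`), and there are at most `(n + 1)² (‖w‖₋₁ + 1)²`
keys (`card_keys_le`). -/

namespace InvSpan

noncomputable section

/-! ### Minimizing `b - a` over half-planes -/

/-- The half-planes `Γ i ≤ X i * b - Y i * a`, `i < m`, contain all points `(a, b)` of `B`, and `d` is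
a lower bound of `b - a` on `B` which is implied by pairs of these half-planes and attained on their
intersection. -/
structure Good (B : Set (ℝ × ℝ)) (m : ℕ) (X Y Γ : ℕ → ℝ) (d : ℝ) : Prop where
  X_nonneg : ∀ i < m, 0 ≤ X i
  Y_nonneg : ∀ i < m, 0 ≤ Y i
  valid : ∀ i < m, ∀ x ∈ B, Γ i ≤ X i * x.2 - Y i * x.1
  nonneg : 0 ≤ d
  le_width : ∀ x ∈ B, d ≤ x.2 - x.1
  diag : ∀ i < m, X i = Y i → Γ i ≤ X i * d
  pair : ∀ i < m, ∀ j < m, Y i < X i → X j < Y j →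
    Γ i * (Y j - X j) + Γ j * (X i - Y i) ≤ d * (X i * Y j - X j * Y i)

/-- The lower bound of `b - a` implied by the half-planes `i` and `j`. -/
def pairBound (X Y Γ : ℕ → ℝ) (i j : ℕ) : ℝ :=
  (Γ i * (Y j - X j) + Γ j * (X i - Y i)) / (X i * Y j - X j * Y i)

lemma pairBound_symm (X Y Γ : ℕ → ℝ) (i j : ℕ) : pairBound X Y Γ i j = pairBound X Y Γ j i := by
  unfold pairBound
  rw [← neg_div_neg_eq]
  congr 1 <;> ring

/-- Adding the two inequalities with the nonnegative weights `Y j - X j` and `X i - Y i` gives `b`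
and `-a` the same coefficient, the determinant `X i * Y j - X j * Y i`. -/
lemma pairBound_le_width_of_le {X Y Γ : ℕ → ℝ} {i j : ℕ} {a b : ℝ} (hXj : 0 ≤ X j)
    (hYi : 0 ≤ Y i) (hi : Γ i ≤ X i * b - Y i * a) (hj : Γ j ≤ X j * b - Y j * a)
    (hab : a ≤ b) (h₁ : Y i ≤ X i) (h₂ : X j ≤ Y j) : pairBound X Y Γ i j ≤ b - a := by
  have hD : 0 ≤ X i * Y j - X j * Y i := by nlinarith
  rcases hD.eq_or_lt with h | h
  -- If the determinant vanishes, `x / 0 = 0` makes the bound trivial, so the program needs no test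
  -- for it.
  · rw [pairBound, ← h, div_zero]; linarith
  · rw [pairBound, div_le_iff₀ h]
    nlinarith [mul_le_mul_of_nonneg_right hi (sub_nonneg.2 h₂),
      mul_le_mul_of_nonneg_right hj (sub_nonneg.2 h₁)]

lemma pairBound_le_width {X Y Γ : ℕ → ℝ} {i j : ℕ} {a b : ℝ} (hXi : 0 ≤ X i) (hXj : 0 ≤ X j)
    (hYi : 0 ≤ Y i) (hYj : 0 ≤ Y j) (hi : Γ i ≤ X i * b - Y i * a)
    (hj : Γ j ≤ X j * b - Y j * a) (hab : a ≤ b) (h : (X i - Y i) * (X j - Y j) ≤ 0) :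
    pairBound X Y Γ i j ≤ b - a := by
  rcases mul_nonpos_iff.1 h with ⟨h₁, h₂⟩ | ⟨h₁, h₂⟩
  · exact pairBound_le_width_of_le hXj hYi hi hj hab (by linarith) (by linarith)
  · rw [pairBound_symm]
    exact pairBound_le_width_of_le hXi hYj hj hi hab (by linarith) (by linarith)

lemma diag_le_width {x y γ a b : ℝ} (hx : 0 ≤ x) (hxy : x = y) (h : γ ≤ x * b - y * a)
    (hab : a ≤ b) : γ / x ≤ b - a := by
  subst hxy
  rcases hx.eq_or_lt with h0 | h0
  · rw [← h0, div_zero]; linarith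
  · rw [div_le_iff₀ h0]; linarith

namespace Good

variable {B : Set (ℝ × ℝ)} {m : ℕ} {X Y Γ X' Y' Γ' : ℕ → ℝ} {d d' : ℝ}

lemma congr (h : Good B m X Y Γ d) (hX : ∀ i < m, X' i = X i) (hY : ∀ i < m, Y' i = Y i)
    (hΓ : ∀ i < m, Γ' i = Γ i) : Good B m X' Y' Γ' d where
  X_nonneg i hi := by rw [hX i hi]; exact h.X_nonneg i hi
  Y_nonneg i hi := by rw [hY i hi]; exact h.Y_nonneg i hi
  valid i hi := by rw [hX i hi, hY i hi, hΓ i hi]; exact h.valid i hi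
  nonneg := h.nonneg
  le_width := h.le_width
  diag i hi := by rw [hX i hi, hY i hi, hΓ i hi]; exact h.diag i hi
  pair i hi j hj := by
    rw [hX i hi, hY i hi, hΓ i hi, hX j hj, hY j hj, hΓ j hj]; exact h.pair i hi j hj

/-- The conditions on the old half-planes are monotone in `d`, so only the new one alone and its
pairs with old ones have to be checked. -/
lemma insert (h : Good B m X Y Γ d) (hX : 0 ≤ X m) (hY : 0 ≤ Y m)
    (hv : ∀ x ∈ B, Γ m ≤ X m * x.2 - Y m * x.1) (hd : d ≤ d') (hw : ∀ x ∈ B, d' ≤ x.2 - x.1)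
    (hdiag : X m = Y m → Γ m / X m ≤ d') (h0 : ¬ (X m ≤ 0 ∧ Y m ≤ 0 ∧ ¬ Γ m ≤ 0))
    (hp : ∀ i < m, (X i - Y i) * (X m - Y m) ≤ 0 → pairBound X Y Γ i m ≤ d') :
    Good B (m + 1) X Y Γ d' := by
  refine ⟨?_, ?_, ?_, h.nonneg.trans hd, hw, ?_, ?_⟩
  · intro i hi
    rcases Nat.lt_succ_iff_lt_or_eq.1 hi with hi | rfl
    exacts [h.X_nonneg i hi, hX]
  · intro i hi
    rcases Nat.lt_succ_iff_lt_or_eq.1 hi with hi | rfl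
    exacts [h.Y_nonneg i hi, hY]
  · intro i hi
    rcases Nat.lt_succ_iff_lt_or_eq.1 hi with hi | rfl
    exacts [h.valid i hi, hv]
  · intro i hi hXY
    rcases Nat.lt_succ_iff_lt_or_eq.1 hi with hi | rfl
    · exact (h.diag i hi hXY).trans (mul_le_mul_of_nonneg_left hd (h.X_nonneg i hi))
    · rcases hX.eq_or_lt with hx | hx
      · rw [← hx, zero_mul]
        by_contra hΓ
        exact h0 ⟨hx.ge, by rw [← hXY]; exact hx.ge, hΓ⟩
      · have := hdiag hXY
        rw [div_le_iff₀ hx] at this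
        linarith
  · intro i hi j hj h₁ h₂
    rcases Nat.lt_succ_iff_lt_or_eq.1 hi with hi | rfl
    · have hD : 0 < X i * Y j - X j * Y i := by
        have := h.Y_nonneg i hi
        have : 0 ≤ X j := by
          rcases Nat.lt_succ_iff_lt_or_eq.1 hj with hj | rfl
          exacts [h.X_nonneg j hj, hX]
        nlinarith
      rcases Nat.lt_succ_iff_lt_or_eq.1 hj with hj | rfl
      · exact (h.pair i hi j hj h₁ h₂).trans (mul_le_mul_of_nonneg_right hd hD.le)
      · have := hp i hi (mul_nonpos_of_nonneg_of_nonpos (by linarith) (by linarith))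
        rwa [pairBound, div_le_iff₀ hD] at this
    · rcases Nat.lt_succ_iff_lt_or_eq.1 hj with hj | rfl
      · have hD : 0 < X i * Y j - X j * Y i := by
          have := h.X_nonneg j hj
          nlinarith
        have := hp j hj (mul_nonpos_of_nonpos_of_nonneg (by linarith) (by linarith))
        rwa [pairBound_symm, pairBound, div_le_iff₀ hD] at this
      · linarith

/-- Moving `a` to the boundary of a violated half-plane does not leave the other ones. -/
lemma correct (h : Good B m X Y Γ d) {a : ℝ} {i : ℕ} (hi : i < m)
    (ha : ∀ j < i, Γ j ≤ X j * (a + d) - Y j * a) (hv : ¬ Γ i ≤ X i * (a + d) - Y i * a) :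
    ∀ j < i + 1, Γ j ≤ X j * ((Γ i - X i * d) / (X i - Y i) + d)
      - Y j * ((Γ i - X i * d) / (X i - Y i)) := by
  set a' := (Γ i - X i * d) / (X i - Y i) with ha'
  -- With equal coefficients the condition on the line `b = a + d` does not involve `a`, and `diag`
  -- says that it holds.
  have hne : X i - Y i ≠ 0 := fun h0 => hv (by
    have hXY : X i = Y i := by linarith
    have := h.diag i hi hXY
    rw [← hXY]; linarith)
  have hai : a' * (X i - Y i) = Γ i - X i * d := div_mul_cancel₀ _ hne
  intro j hj
  rcases Nat.lt_succ_iff_lt_or_eq.1 hj with hj | rfl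
  · have hjm := hj.trans hi
    have hja := ha j hj
    -- On the line, half-plane `i` bounds `a` from above if `X i < Y i` and from below otherwise;
    -- the correction moves `a` in that direction. Half-planes bounding on the same side stay
    -- satisfied, those on the opposite side are handled by `pair`.
    rcases lt_or_gt_of_ne hne with hlt | hgt
    · have haa : a' ≤ a := by
        by_contra hc
        nlinarith [mul_lt_mul_of_neg_right (not_le.1 hc) hlt]
      rcases le_or_gt (X j) (Y j) with hXY | hXY
      · nlinarith [mul_le_mul_of_nonneg_right haa (sub_nonneg.2 hXY)]
      · have := h.pair j hjm i hi hXY (by linarith)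
        have h1 : 0 < Y i - X i := by linarith
        refine le_of_mul_le_mul_right ?_ h1
        nlinarith
    · have haa : a ≤ a' := by
        by_contra hc
        nlinarith [mul_lt_mul_of_pos_right (not_le.1 hc) hgt]
      rcases le_or_gt (Y j) (X j) with hXY | hXY
      · nlinarith [mul_le_mul_of_nonneg_right haa (sub_nonneg.2 hXY)]
      · have := h.pair i hi j hjm (by linarith) hXY
        refine le_of_mul_le_mul_right ?_ hgt
        nlinarith
  · linarith

end Good

/-! ### Deviation vectors as points `(a, b)`, and their cuts -/

namespace Problem

variable {n : ℕ} (I : Problem n)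

/-- The upper bound of `s ∈ F*` is smaller than `b / w s`. -/
def Capped (b : ℝ) (s : Fin n) : Prop :=
  s ∈ I.Fstar ∧ I.upper s ≠ ⊤ ∧ I.w s * (I.upper s).toReal < b

/-- The lower bound of `s ∉ F*` is greater than `a / w s`. -/
def Floored (a : ℝ) (s : Fin n) : Prop :=
  s ∉ I.Fstar ∧ I.lower s ≠ ⊥ ∧ a < I.w s * (I.lower s).toReal

open Classical in
/-- The derivative of `dev a b s` with respect to `b`. -/
def slopeHigh (b : ℝ) (s : Fin n) : ℝ :=
  if s ∈ I.Fstar ∧ ¬ I.Capped b s then 1 / I.w s else 0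

open Classical in
/-- The derivative of `dev a b s` with respect to `a`. -/
def slopeLow (a : ℝ) (s : Fin n) : ℝ :=
  if s ∉ I.Fstar ∧ ¬ I.Floored a s then 1 / I.w s else 0

open Classical in
/-- The constant part of `dev a b s`. -/
def offset (a b : ℝ) (s : Fin n) : ℝ :=
  if I.Capped b s then (I.upper s).toReal else if I.Floored a s then (I.lower s).toReal else 0

/-- The vector with weighted entries in `[a, b]` that favours `F*` most: `min (u s) (b / w s)` on `F*`
and `max (ℓ s) (a / w s)` outside of `F*`. -/
def dev (a b : ℝ) (s : Fin n) : ℝ :=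
  I.slopeHigh b s * b + I.slopeLow a s * a + I.offset a b s

/-- The difference of the characteristic functions of `F*` and `G`. -/
def diff (G : Finset (Fin n)) (s : Fin n) : ℝ :=
  (if s ∈ I.Fstar then 1 else 0) - if s ∈ G then 1 else 0

/-- Coefficient of `b` in the linearization at `(a, b)` of the condition that `F*` costs at most as
much as `G`. -/
def cutHigh (b : ℝ) (G : Finset (Fin n)) : ℝ := ∑ s, I.diff G s * I.slopeHigh b s

/-- Negative of the coefficient of `a` in this linearization. -/
def cutLow (a : ℝ) (G : Finset (Fin n)) : ℝ := -∑ s, I.diff G s * I.slopeLow a s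

/-- Right hand side of this linearization. -/
def cutConst (a b : ℝ) (G : Finset (Fin n)) : ℝ := ∑ s, I.diff G s * (I.c s - I.offset a b s)

/-- The points `(a, b)` such that some feasible deviation vector has its weighted entries between `a`
and `b`. -/
def brackets : Set (ℝ × ℝ) :=
  {x | ∃ q, I.IsFeasible q ∧ ∀ s, x.1 ≤ I.w s * q s ∧ I.w s * q s ≤ x.2}

lemma sum_diff_mul (G : Finset (Fin n)) (f : Fin n → ℝ) :
    ∑ s, I.diff G s * f s = ∑ s ∈ I.Fstar, f s - ∑ s ∈ G, f s := by
  simp [diff, sub_mul, Finset.sum_sub_distrib]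

/-- The cost gap is exactly the violation of the linearization at its own base point, so a
minimum-cost member yields a most violated cut. -/
lemma cost_diff (a b : ℝ) (G : Finset (Fin n)) :
    ∑ s ∈ I.Fstar, (I.c s - I.dev a b s) - ∑ s ∈ G, (I.c s - I.dev a b s) =
      I.cutConst a b G - (I.cutHigh b G * b - I.cutLow a G * a) := by
  rw [← sum_diff_mul, cutConst, cutHigh, cutLow, Finset.sum_mul, neg_mul, Finset.sum_mul,
    sub_neg_eq_add, ← Finset.sum_add_distrib, ← Finset.sum_sub_distrib]
  exact Finset.sum_congr rfl fun s _ => by rw [dev]; ring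

/-- Only uncapped elements of `F* \ G` contribute, each with the integer `1 / w s`: the slope
vanishes off `F*`, the difference on `F* ∩ G`. -/
lemma exists_cutHigh_eq (b : ℝ) (G : Finset (Fin n)) :
    ∃ x : ℕ, I.cutHigh b G = x ∧ (x : ℝ) ≤ I.invNorm := by
  classical
  choose k hk using I.inv_w_integral
  refine ⟨∑ s, if s ∈ I.Fstar ∧ ¬ I.Capped b s ∧ s ∉ G then k s else 0, ?_, ?_⟩
  · rw [cutHigh, Nat.cast_sum]
    refine Finset.sum_congr rfl fun s _ => ?_
    rw [slopeHigh, diff, hk]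
    by_cases h₁ : s ∈ I.Fstar <;> by_cases h₂ : s ∈ G <;> by_cases h₃ : I.Capped b s <;>
      simp [h₁, h₂, h₃]
  · rw [invNorm, Nat.cast_sum]
    refine Finset.sum_le_sum fun s _ => ?_
    rw [hk]
    split_ifs <;> simp

lemma exists_cutLow_eq (a : ℝ) (G : Finset (Fin n)) :
    ∃ x : ℕ, I.cutLow a G = x ∧ (x : ℝ) ≤ I.invNorm := by
  classical
  choose k hk using I.inv_w_integral
  refine ⟨∑ s, if s ∉ I.Fstar ∧ ¬ I.Floored a s ∧ s ∈ G then k s else 0, ?_, ?_⟩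
  · rw [cutLow, Nat.cast_sum, ← Finset.sum_neg_distrib]
    refine Finset.sum_congr rfl fun s _ => ?_
    rw [slopeLow, diff, hk]
    by_cases h₁ : s ∈ I.Fstar <;> by_cases h₂ : s ∈ G <;> by_cases h₃ : I.Floored a s <;>
      simp [h₁, h₂, h₃]
  · rw [invNorm, Nat.cast_sum]
    refine Finset.sum_le_sum fun s _ => ?_
    rw [hk]
    split_ifs <;> simp

variable {I} in
lemma IsFeasible.le_upper {q : Fin n → ℝ} (h : I.IsFeasible q) {s : Fin n}
    (hs : I.upper s ≠ ⊤) : q s ≤ (I.upper s).toReal :=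
  EReal.coe_le_coe_iff.1 ((h.2 s).2.trans (EReal.le_coe_toReal hs))

variable {I} in
lemma IsFeasible.lower_le {q : Fin n → ℝ} (h : I.IsFeasible q) {s : Fin n}
    (hs : I.lower s ≠ ⊥) : (I.lower s).toReal ≤ q s :=
  EReal.coe_le_coe_iff.1 ((EReal.coe_toReal_le hs).trans (h.2 s).1)

lemma valid_upper {x : ℝ × ℝ} (hx : x ∈ I.brackets) {s : Fin n} (hs : I.upper s ≠ ⊤) :
    x.1 ≤ I.w s * (I.upper s).toReal := by
  obtain ⟨q, hq, h⟩ := hx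
  exact (h s).1.trans (mul_le_mul_of_nonneg_left (hq.le_upper hs) (I.w_pos s).le)

lemma valid_lower {x : ℝ × ℝ} (hx : x ∈ I.brackets) {s : Fin n} (hs : I.lower s ≠ ⊥) :
    I.w s * (I.lower s).toReal ≤ x.2 := by
  obtain ⟨q, hq, h⟩ := hx
  exact (mul_le_mul_of_nonneg_left (hq.lower_le hs) (I.w_pos s).le).trans (h s).2

/-- The linearizations are valid for all feasible deviation vectors. -/
lemma valid_cut {x : ℝ × ℝ} (hx : x ∈ I.brackets) (a b : ℝ) {G : Finset (Fin n)}
    (hG : G ∈ I.feas) : I.cutConst a b G ≤ I.cutHigh b G * x.2 - I.cutLow a G * x.1 := by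
  obtain ⟨q, hq, h⟩ := hx
  have h1 : ∑ s, I.diff G s * (I.c s - q s) ≤ 0 := by
    rw [sum_diff_mul]; linarith [hq.1.2 G hG]
  -- Termwise: on `F*` the factor `diff` is nonnegative and `q s` is at most both `u s` and `x.2 / w
  -- s`, whichever is used at `(a, b)`; off `F*` both signs are reversed.
  have h2 : ∑ s, I.diff G s *
      (I.c s - I.offset a b s - I.slopeHigh b s * x.2 - I.slopeLow a s * x.1) ≤
      ∑ s, I.diff G s * (I.c s - q s) := by
    refine Finset.sum_le_sum fun s _ => ?_
    have hw := I.w_pos s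
    have hq1 : x.1 / I.w s ≤ q s := by rw [div_le_iff₀ hw]; linarith [(h s).1]
    have hq2 : q s ≤ x.2 / I.w s := by rw [le_div_iff₀ hw]; linarith [(h s).2]
    by_cases hF : s ∈ I.Fstar
    · have hFl : ¬ I.Floored a s := fun hc => hc.1 hF
      have hd : 0 ≤ I.diff G s := by rw [diff, if_pos hF]; split_ifs <;> norm_num
      refine mul_le_mul_of_nonneg_left ?_ hd
      by_cases hc : I.Capped b s
      · simp only [offset, slopeHigh, slopeLow, hF, hc]
        have := hq.le_upper hc.2.1
        simp [hF]; linarith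
      · simp only [offset, slopeHigh, slopeLow, hF, hc, hFl]
        simp; rw [inv_mul_eq_div]; linarith
    · have hFl : ¬ I.Capped b s := fun hc => hF hc.1
      have hd : I.diff G s ≤ 0 := by rw [diff, if_neg hF]; split_ifs <;> norm_num
      refine mul_le_mul_of_nonpos_left ?_ hd
      by_cases hc : I.Floored a s
      · simp only [offset, slopeHigh, slopeLow, hF, hc, hFl]
        have := hq.lower_le hc.2.1
        simp; linarith
      · simp only [offset, slopeHigh, slopeLow, hF, hc, hFl]
        simp; rw [inv_mul_eq_div]; linarith
  have h3 : ∑ s, I.diff G s *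
      (I.c s - I.offset a b s - I.slopeHigh b s * x.2 - I.slopeLow a s * x.1) =
      I.cutConst a b G - (I.cutHigh b G * x.2 - I.cutLow a G * x.1) := by
    rw [cutConst, cutHigh, cutLow, Finset.sum_mul, neg_mul, Finset.sum_mul,
      sub_neg_eq_add, ← Finset.sum_add_distrib, ← Finset.sum_sub_distrib]
    exact Finset.sum_congr rfl fun s _ => by ring
  linarith

/-- `a` and `b` are compatible with the bounds. -/
def Compatible (a b : ℝ) (s : Fin n) : Prop :=
  (I.upper s ≠ ⊤ → a ≤ I.w s * (I.upper s).toReal) ∧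
    (I.lower s ≠ ⊥ → I.w s * (I.lower s).toReal ≤ b)

/-- Clipping at a bound could leave `[a, b]`, or an end of `[a, b]` violate the opposite bound, only
if some `w s * u s < a` or `b < w s * ℓ s`; compatibility excludes this. -/
lemma dev_bounds {a b : ℝ} {s : Fin n} (hab : a ≤ b) (h : I.Compatible a b s) :
    (a ≤ I.w s * I.dev a b s ∧ I.w s * I.dev a b s ≤ b) ∧
      I.lower s ≤ (I.dev a b s : EReal) ∧ (I.dev a b s : EReal) ≤ I.upper s := by
  have hw := I.w_pos s
  have lower_of {x : ℝ} (hx : I.lower s ≠ ⊥ → I.w s * (I.lower s).toReal ≤ I.w s * x) :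
      I.lower s ≤ (x : EReal) := by
    by_cases hs : I.lower s = ⊥
    · simp [hs]
    · rw [← EReal.coe_toReal (I.lower_ne_top s) hs, EReal.coe_le_coe_iff]
      exact le_of_mul_le_mul_left (hx hs) hw
  have upper_of {x : ℝ} (hx : I.upper s ≠ ⊤ → I.w s * x ≤ I.w s * (I.upper s).toReal) :
      (x : EReal) ≤ I.upper s := by
    by_cases hs : I.upper s = ⊤
    · simp [hs]
    · rw [← EReal.coe_toReal hs (I.upper_ne_bot s), EReal.coe_le_coe_iff]
      exact le_of_mul_le_mul_left (hx hs) hw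
  by_cases hF : s ∈ I.Fstar
  · have hFl : ¬ I.Floored a s := fun hc => hc.1 hF
    by_cases hc : I.Capped b s
    · have hdev : I.dev a b s = (I.upper s).toReal := by
        simp [dev, offset, slopeHigh, slopeLow, hF, hc]
      rw [hdev, EReal.coe_toReal hc.2.1 (I.upper_ne_bot s)]
      exact ⟨⟨h.1 hc.2.1, hc.2.2.le⟩, I.lower_le_upper s, le_rfl⟩
    · have hdev : I.w s * I.dev a b s = b := by
        simp [dev, offset, slopeHigh, slopeLow, hF, hc, hFl, hw.ne']
      refine ⟨by rw [hdev]; exact ⟨hab, le_rfl⟩, lower_of fun hs => ?_, upper_of fun hs => ?_⟩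
      · rw [hdev]; exact h.2 hs
      · rw [hdev]; exact not_lt.1 fun hlt => hc ⟨hF, hs, hlt⟩
  · have hCa : ¬ I.Capped b s := fun hc => hF hc.1
    by_cases hc : I.Floored a s
    · have hdev : I.dev a b s = (I.lower s).toReal := by
        simp [dev, offset, slopeHigh, slopeLow, hF, hc, hCa]
      rw [hdev, EReal.coe_toReal (I.lower_ne_top s) hc.2.1]
      exact ⟨⟨hc.2.2.le, h.2 hc.2.1⟩, le_rfl, I.lower_le_upper s⟩
    · have hdev : I.w s * I.dev a b s = a := by
        simp [dev, offset, slopeHigh, slopeLow, hF, hc, hCa, hw.ne']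
      refine ⟨by rw [hdev]; exact ⟨le_rfl, hab⟩, lower_of fun hs => ?_, upper_of fun hs => ?_⟩
      · rw [hdev]; exact not_lt.1 fun hlt => hc ⟨hF, hs, hlt⟩
      · rw [hdev]; exact h.1 hs

variable {I} in
lemma IsFeasible.mem_brackets {q : Fin n → ℝ} (hq : I.IsFeasible q) :
    (⨅ s, I.w s * q s, ⨆ s, I.w s * q s) ∈ I.brackets :=
  ⟨q, hq, fun s => ⟨ciInf_le (Set.finite_range _).bddBelow s,
    le_ciSup (Set.finite_range fun s => I.w s * q s).bddAbove s⟩⟩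

lemma le_of_mem_brackets [NeZero n] {x : ℝ × ℝ} (hx : x ∈ I.brackets) : x.1 ≤ x.2 := by
  obtain ⟨q, -, h⟩ := hx
  exact (h 0).1.trans (h 0).2

/-- If the minimum-cost member `G` for `dev a b` does not violate its linearization, and `b - a` is a
lower bound of the weighted span of feasible deviation vectors, then `dev a b` is optimal. -/
lemma isOptimal_dev [NeZero n] {a b : ℝ} (hab : a ≤ b) (hc : ∀ s, I.Compatible a b s)
    {G : Finset (Fin n)} (hG : IsMinCost I.feas (fun s => I.c s - I.dev a b s) G)
    (hcut : I.cutConst a b G ≤ I.cutHigh b G * b - I.cutLow a G * a)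
    (hle : ∀ x ∈ I.brackets, b - a ≤ x.2 - x.1) : I.IsOptimal (I.dev a b) := by
  have hf : I.IsFeasible (I.dev a b) := by
    refine ⟨⟨I.Fstar_mem, fun H hH => ?_⟩, fun s => (I.dev_bounds hab (hc s)).2⟩
    -- As the cut is satisfied, `F*` costs no more than the minimum-cost member `G`.
    have := I.cost_diff a b G
    linarith [hG.2 H hH]
  refine ⟨hf, fun q hq => ?_⟩
  have h1 : (⨆ s, I.w s * I.dev a b s) ≤ b := ciSup_le fun s => (I.dev_bounds hab (hc s)).1.2
  have h2 : a ≤ ⨅ s, I.w s * I.dev a b s := le_ciInf fun s => (I.dev_bounds hab (hc s)).1.1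
  have := hle _ hq.mem_brackets
  simp only [wspan] at *
  linarith

/-! ### Counting violated cuts -/

open Classical in
/-- A violated linearization at `(a, b)` is determined, up to its constant, by this quadruple. -/
def key (a b : ℝ) (G : Finset (Fin n)) : ℕ × ℕ × ℕ × ℕ :=
  (({s | I.Capped b s} : Finset (Fin n)).card, ({s | I.Floored a s} : Finset (Fin n)).card,
    ⌊I.cutHigh b G⌋₊, ⌊I.cutLow a G⌋₊)

/-- The possible values of `key`. -/
def keys : Finset (ℕ × ℕ × ℕ × ℕ) :=
  Finset.range (n + 1) ×ˢ Finset.range (n + 1) ×ˢ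
    Finset.range (⌊I.invNorm⌋₊ + 1) ×ˢ Finset.range (⌊I.invNorm⌋₊ + 1)

lemma key_mem_keys (a b : ℝ) (G : Finset (Fin n)) : I.key a b G ∈ I.keys := by
  obtain ⟨x, hx, hx'⟩ := I.exists_cutHigh_eq b G
  obtain ⟨y, hy, hy'⟩ := I.exists_cutLow_eq a G
  simp only [key, keys, Finset.mem_product, Finset.mem_range, Nat.lt_succ_iff]
  refine ⟨(Finset.card_le_univ _).trans (by simp), (Finset.card_le_univ _).trans (by simp), ?_, ?_⟩
  · rw [hx]; exact Nat.floor_mono hx'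
  · rw [hy]; exact Nat.floor_mono hy'

/-- The capped sets grow with `b`, so they form a chain and their size determines them. -/
lemma capped_iff_of_card_eq {b b' : ℝ} [DecidablePred (I.Capped b)] [DecidablePred (I.Capped b')]
    (h : ({s | I.Capped b s} : Finset (Fin n)).card =
      ({s | I.Capped b' s} : Finset (Fin n)).card) (s : Fin n) :
    I.Capped b s ↔ I.Capped b' s := by
  have key : ({s | I.Capped b s} : Finset (Fin n)) =
      ({s | I.Capped b' s} : Finset (Fin n)) := by
    rcases le_total b b' with hb | hb
    · exact Finset.eq_of_subset_of_card_le
        (Finset.monotone_filter_right _ fun s _ hs => ⟨hs.1, hs.2.1, hs.2.2.trans_le hb⟩) h.ge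
    · exact (Finset.eq_of_subset_of_card_le
        (Finset.monotone_filter_right _ fun s _ hs => ⟨hs.1, hs.2.1, hs.2.2.trans_le hb⟩) h.le).symm
  simpa using Finset.ext_iff.1 key s

lemma floored_iff_of_card_eq {a a' : ℝ} [DecidablePred (I.Floored a)]
    [DecidablePred (I.Floored a')]
    (h : ({s | I.Floored a s} : Finset (Fin n)).card =
      ({s | I.Floored a' s} : Finset (Fin n)).card) (s : Fin n) :
    I.Floored a s ↔ I.Floored a' s := by
  have key : ({s | I.Floored a s} : Finset (Fin n)) =
      ({s | I.Floored a' s} : Finset (Fin n)) := by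
    rcases le_total a' a with ha | ha
    · exact Finset.eq_of_subset_of_card_le
        (Finset.monotone_filter_right _ fun s _ hs => ⟨hs.1, hs.2.1, ha.trans_lt hs.2.2⟩) h.ge
    · exact (Finset.eq_of_subset_of_card_le
        (Finset.monotone_filter_right _ fun s _ hs => ⟨hs.1, hs.2.1, ha.trans_lt hs.2.2⟩) h.le).symm
  simpa using Finset.ext_iff.1 key s

/-- Every key in `K` belongs to a linearization, at a minimum-cost member, that is among the
half-planes `i < m`. -/
def Recorded (m : ℕ) (X Y Γ : ℕ → ℝ) (K : Finset (ℕ × ℕ × ℕ × ℕ)) : Prop :=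
  ∀ k ∈ K, ∃ i < m, ∃ a b G, IsMinCost I.feas (fun s => I.c s - I.dev a b s) G ∧
    I.key a b G = k ∧ X i = I.cutHigh b G ∧ Y i = I.cutLow a G ∧ Γ i = I.cutConst a b G

/-- A violated linearization at a point satisfying all recorded ones has a new key. -/
lemma key_notMem {m : ℕ} {X Y Γ : ℕ → ℝ} {K : Finset (ℕ × ℕ × ℕ × ℕ)}
    (hK : I.Recorded m X Y Γ K) {a b : ℝ} (hs : ∀ i < m, Γ i ≤ X i * b - Y i * a)
    {G : Finset (Fin n)} (hG : G ∈ I.feas)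
    (hv : ¬ I.cutConst a b G ≤ I.cutHigh b G * b - I.cutLow a G * a) : I.key a b G ∉ K := by
  classical
  intro hk
  obtain ⟨i, hi, a₀, b₀, G₀, hG₀, hkey, hX, hY, hΓ⟩ := hK _ hk
  simp only [key, Prod.mk.injEq] at hkey
  obtain ⟨h1, h2, h3, h4⟩ := hkey
  have hC := I.capped_iff_of_card_eq h1
  have hFl := I.floored_iff_of_card_eq h2
  have hhigh (H) : I.cutHigh b₀ H = I.cutHigh b H := by simp only [cutHigh, slopeHigh, hC]
  have hlow (H) : I.cutLow a₀ H = I.cutLow a H := by simp only [cutLow, slopeLow, hFl]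
  have hconst (H) : I.cutConst a₀ b₀ H = I.cutConst a b H := by
    simp only [cutConst, offset, hC, hFl]
  -- The floors in the key lose nothing, since the coefficients are natural numbers.
  have e1 : I.cutHigh b G₀ = I.cutHigh b G := by
    obtain ⟨x, hx, -⟩ := I.exists_cutHigh_eq b G₀
    obtain ⟨y, hy, -⟩ := I.exists_cutHigh_eq b G
    rw [hhigh, hx, hy, Nat.floor_natCast, Nat.floor_natCast] at h3
    rw [hx, hy, h3]
  have e2 : I.cutLow a G₀ = I.cutLow a G := by
    obtain ⟨x, hx, -⟩ := I.exists_cutLow_eq a G₀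
    obtain ⟨y, hy, -⟩ := I.exists_cutLow_eq a G
    rw [hlow, hx, hy, Nat.floor_natCast, Nat.floor_natCast] at h4
    rw [hx, hy, h4]
  -- At `(a₀, b₀)` the member `G₀` costs no more than `G`, so with equal linear parts its constant
  -- is at least that of `G`. Since `(a, b)` satisfies the recorded cut of `G₀`, it satisfies that
  -- of `G`.
  have c1 := I.cost_diff a₀ b₀ G₀
  have c2 := I.cost_diff a₀ b₀ G
  have c3 := hG₀.2 G hG
  have c4 := hs i hi
  rw [hhigh, hlow, hconst, e1, e2] at c1
  rw [hhigh, hlow, hconst] at c2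
  rw [hX, hY, hΓ, hhigh, hlow, hconst, e1, e2] at c4
  exact hv (by linarith)

/-- Each `1 / w s` is a positive integer, so `‖w‖₋₁ ≥ 1`; doubling absorbs each `+ 1`, which gives
the factor `16`, and the final call adds `1`. The count is only quadratic in `‖w‖₋₁`; the sixth
power is slack. -/
lemma card_keys_le (hn : n ≠ 0) :
    ((I.keys.card + 1 : ℕ) : ℝ) ≤ 17 * ((n : ℝ) ^ 2 * I.invNorm ^ 6) := by
  have hpos : ∀ s, 0 ≤ 1 / I.w s := fun s => (one_div_pos.2 (I.w_pos s)).le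
  have h1 : 1 ≤ I.invNorm := by
    let s : Fin n := ⟨0, Nat.pos_of_ne_zero hn⟩
    have h2 : 1 / I.w s ≤ I.invNorm :=
      Finset.single_le_sum (f := fun s => 1 / I.w s) (fun s _ => hpos s) (Finset.mem_univ s)
    refine le_trans ?_ h2
    obtain ⟨k, hk⟩ := I.inv_w_integral s
    have h3 := one_div_pos.2 (I.w_pos s)
    rw [hk] at h3 ⊢
    exact_mod_cast h3
  have hn1 : (1 : ℝ) ≤ n := by exact_mod_cast Nat.one_le_iff_ne_zero.2 hn
  have hfl : ((⌊I.invNorm⌋₊ : ℕ) : ℝ) ≤ I.invNorm := Nat.floor_le (by linarith)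
  have hcard : ((I.keys.card + 1 : ℕ) : ℝ) =
      (((n : ℝ) + 1) * (⌊I.invNorm⌋₊ + 1)) ^ 2 + 1 := by
    simp only [keys, Finset.card_product, Finset.card_range]
    push_cast; ring
  have h2 : ((n : ℝ) + 1) * (⌊I.invNorm⌋₊ + 1) ≤ (2 * n) * (2 * I.invNorm) := by
    refine mul_le_mul (by linarith) (by linarith) (by positivity) (by positivity)
  have h3 : (1 : ℝ) ≤ (n : ℝ) ^ 2 * I.invNorm ^ 6 := by
    nlinarith [one_le_pow₀ (n := 2) hn1, one_le_pow₀ (n := 6) h1]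
  calc ((I.keys.card + 1 : ℕ) : ℝ) = (((n : ℝ) + 1) * (⌊I.invNorm⌋₊ + 1)) ^ 2 + 1 := hcard
    _ ≤ ((2 * n) * (2 * I.invNorm)) ^ 2 + (n : ℝ) ^ 2 * I.invNorm ^ 6 :=
        add_le_add (pow_le_pow_left₀ (by positivity) h2 2) h3
    _ = 16 * ((n : ℝ) ^ 2 * I.invNorm ^ 2) + (n : ℝ) ^ 2 * I.invNorm ^ 6 := by ring
    _ ≤ 16 * ((n : ℝ) ^ 2 * I.invNorm ^ 6) + (n : ℝ) ^ 2 * I.invNorm ^ 6 := by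
        gcongr
        norm_num
    _ = _ := by ring

end Problem

/-! ### Total correctness rules for programs -/

/-- With the oracle `O`, the program `P` started in `σ` halts in a state satisfying `Q`. -/
def Reaches {n : ℕ} (O : (Fin n → ℝ) → Finset (Fin n)) (P : Prog) (σ : State)
    (Q : State → Prop) : Prop :=
  ∃ τ, Exec O P σ τ ∧ Q τ

/-- Storing a natural number. -/
def State.setN (σ : State) (a i x : ℕ) : State :=
  ⟨Function.update σ.nat a (Function.update (σ.nat a) i x), σ.real, σ.calls⟩

/-- Storing a real number. -/
def State.setR (σ : State) (a i : ℕ) (x : ℝ) : State :=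
  ⟨σ.nat, Function.update σ.real a (Function.update (σ.real a) i x), σ.calls⟩

@[simp] lemma State.setN_nat_self (σ : State) (a i x : ℕ) :
    (σ.setN a i x).nat a = Function.update (σ.nat a) i x := by simp [setN]

@[simp] lemma State.setN_nat_ne (σ : State) {a a' : ℕ} (i x : ℕ) (h : a' ≠ a) :
    (σ.setN a i x).nat a' = σ.nat a' := by simp [setN, h]

@[simp] lemma State.setN_real (σ : State) (a i x : ℕ) : (σ.setN a i x).real = σ.real := rfl

@[simp] lemma State.setN_calls (σ : State) (a i x : ℕ) : (σ.setN a i x).calls = σ.calls := rfl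

@[simp] lemma State.setR_real_self (σ : State) (a i : ℕ) (x : ℝ) :
    (σ.setR a i x).real a = Function.update (σ.real a) i x := by simp [setR]

@[simp] lemma State.setR_real_ne (σ : State) {a a' : ℕ} (i : ℕ) (x : ℝ) (h : a' ≠ a) :
    (σ.setR a i x).real a' = σ.real a' := by simp [setR, h]

@[simp] lemma State.setR_nat (σ : State) (a i : ℕ) (x : ℝ) : (σ.setR a i x).nat = σ.nat := rfl

@[simp] lemma State.setR_calls (σ : State) (a i : ℕ) (x : ℝ) :
    (σ.setR a i x).calls = σ.calls := rfl

/-- `for v < e do P`, with the loop variable in entry `0` of the natural array `v`. -/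
def forLoop (v : ℕ) (e : NExp) (P : Prog) : Prog :=
  .seq (.setNat v (.const 0) (.const 0))
    (.loop (.not (.natLe e (.get v (.const 0))))
      (.seq P (.setNat v (.const 0) (.add (.get v (.const 0)) (.const 1)))))

namespace Reaches

variable {n : ℕ} {O : (Fin n → ℝ) → Finset (Fin n)} {P P' : Prog} {σ : State}
  {Q R : State → Prop}

lemma mono (h : Reaches O P σ Q) (hQ : ∀ τ, Q τ → R τ) : Reaches O P σ R :=
  let ⟨τ, h₁, h₂⟩ := h
  ⟨τ, h₁, hQ τ h₂⟩

lemma skip (h : Q σ) : Reaches O .skip σ Q := ⟨σ, .skip σ, h⟩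

lemma setNat {a : ℕ} {i x : NExp} (h : Q (σ.setN a (i.eval σ) (x.eval σ))) :
    Reaches O (.setNat a i x) σ Q := ⟨_, .setNat σ a i x, h⟩

lemma setReal {a : ℕ} {i : NExp} {x : RExp} (h : Q (σ.setR a (i.eval σ) (x.eval σ))) :
    Reaches O (.setReal a i x) σ Q := ⟨_, .setReal σ a i x, h⟩

lemma oracle {a b : ℕ}
    (h : Q ⟨Function.update σ.nat b (charVec (O fun s => σ.real a s)), σ.real, σ.calls + 1⟩) :
    Reaches O (.oracle a b) σ Q := ⟨_, .oracle σ a b, h⟩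

lemma seq (h : Reaches O P σ fun τ => Reaches O P' τ Q) : Reaches O (.seq P P') σ Q :=
  let ⟨_, h₁, ρ, h₂, h₃⟩ := h
  ⟨ρ, .seq h₁ h₂, h₃⟩

lemma ite {b : BExp} (h₁ : b.Holds σ → Reaches O P σ Q) (h₂ : ¬ b.Holds σ → Reaches O P' σ Q) :
    Reaches O (.ite b P P') σ Q := by
  by_cases hb : b.Holds σ
  · obtain ⟨τ, h, hQ⟩ := h₁ hb
    exact ⟨τ, .ite_true hb h, hQ⟩
  · obtain ⟨τ, h, hQ⟩ := h₂ hb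
    exact ⟨τ, .ite_false hb h, hQ⟩

/-- Strong induction on the variant `μ`, which proves termination along with the invariant. -/
lemma loop {b : BExp} (μ : State → ℕ) (hσ : Q σ)
    (h : ∀ τ, Q τ → b.Holds τ → Reaches O P τ fun ρ => Q ρ ∧ μ ρ < μ τ) :
    Reaches O (.loop b P) σ fun τ => Q τ ∧ ¬ b.Holds τ := by
  induction hk : μ σ using Nat.strong_induction_on generalizing σ with
  | _ k ih =>
    by_cases hb : b.Holds σ
    · obtain ⟨τ, h₁, h₂, h₃⟩ := h σ hσ hb
      obtain ⟨ρ, h₄, h₅⟩ := ih (μ τ) (hk ▸ h₃) h₂ rfl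
      exact ⟨ρ, .loop_step hb h₁ h₄, h₅⟩
    · exact ⟨σ, .loop_done hb, hσ, hb⟩

/-- `Inv (i + 1)` is required after the increment of the counter; together with `hb` this forces the
body to preserve the counter. -/
lemma forLoop {v : ℕ} {e : NExp} {Inv : ℕ → State → Prop} (k : ℕ) (h0 : Inv 0 (σ.setN v 0 0))
    (hb : ∀ i τ, Inv i τ → τ.nat v 0 = i ∧ e.eval τ = k)
    (hs : ∀ i < k, ∀ τ, Inv i τ →
      Reaches O P τ fun ρ => Inv (i + 1) (ρ.setN v 0 (ρ.nat v 0 + 1))) :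
    Reaches O (forLoop v e P) σ (Inv k) := by
  refine .seq (.setNat ?_)
  refine mono (loop (Q := fun τ => ∃ i ≤ k, Inv i τ) (fun τ => k - τ.nat v 0) ⟨0, by simp, h0⟩ ?_) ?_
  · rintro τ ⟨i, hi, hτ⟩ h
    obtain ⟨h₁, h₂⟩ := hb i τ hτ
    simp only [BExp.Holds, NExp.eval, h₁, h₂, not_le] at h
    refine .seq (mono (hs i h τ hτ) fun ρ hρ => .setNat ?_)
    have := (hb _ _ hρ).1
    refine ⟨⟨i + 1, h, hρ⟩, ?_⟩
    change k - (ρ.setN v 0 (ρ.nat v 0 + 1)).nat v 0 < _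
    omega
  · rintro τ ⟨⟨i, hi, hτ⟩, h⟩
    obtain ⟨h₁, h₂⟩ := hb i τ hτ
    simp only [BExp.Holds, NExp.eval, h₁, h₂, not_le, not_lt] at h
    rwa [← le_antisymm hi h]

end Reaches

/-- The memory of `σ` and `τ` agrees except for the natural arrays in `A` and the real arrays in
`A'`. -/
structure Agree (A A' : Set ℕ) (σ τ : State) : Prop where
  nat : ∀ a ∉ A, τ.nat a = σ.nat a
  real : ∀ a ∉ A', τ.real a = σ.real a
  calls : τ.calls = σ.calls

namespace Agree

variable {A A' : Set ℕ} {σ τ ρ : State}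

lemma refl (A A' : Set ℕ) (σ : State) : Agree A A' σ σ := ⟨fun _ _ => rfl, fun _ _ => rfl, rfl⟩

lemma trans (h : Agree A A' σ τ) (h' : Agree A A' τ ρ) : Agree A A' σ ρ :=
  ⟨fun a ha => (h'.nat a ha).trans (h.nat a ha), fun a ha => (h'.real a ha).trans (h.real a ha),
    h'.calls.trans h.calls⟩

lemma mono {B B' : Set ℕ} (h : Agree A A' σ τ) (hA : A ⊆ B) (hA' : A' ⊆ B') : Agree B B' σ τ :=
  ⟨fun a ha => h.nat a fun h => ha (hA h), fun a ha => h.real a fun h => ha (hA' h), h.calls⟩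

lemma setN (h : Agree A A' σ τ) {a : ℕ} (ha : a ∈ A) (i x : ℕ) : Agree A A' σ (τ.setN a i x) :=
  ⟨fun a' ha' => by
    rw [State.setN_nat_ne _ _ _ (by rintro rfl; exact ha' ha)]; exact h.nat a' ha', h.real, h.calls⟩

lemma setR (h : Agree A A' σ τ) {a : ℕ} (ha : a ∈ A') (i : ℕ) (x : ℝ) :
    Agree A A' σ (τ.setR a i x) :=
  ⟨h.nat, fun a' ha' => by
    rw [State.setR_real_ne _ _ _ (by rintro rfl; exact ha' ha)]; exact h.real a' ha', h.calls⟩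

end Agree

/-! ### The cutting plane program -/

/-! The programs use the following memory. Natural arrays: `4` and `8` (entry `0`: result, and whether
the main loop goes on), `5` (answer of the oracle), `6` (entry `0`: number `m` of half-planes), `7`
and `9` (loop variables). Real arrays: `4` (deviation vector), `5`, `6`, `7` (the half-planes), `8`
and `9` (entry `0`: `d` and `a`), `10` (cost vector), `11`, `12`, `13` (slopes and offsets). -/

/-- Entry `0` of a natural array. -/
abbrev num (a : ℕ) : NExp := .get a (.const 0)

/-- Entry `0` of a real array. -/
abbrev scalar (a : ℕ) : RExp := .get a (.const 0)

/-- Numerals. -/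
abbrev lit (k : ℕ) : RExp := .ofNat (.const k)

/-- Set `a` such that `(a, a + d)` lies in all half-planes. -/
def solveProg : Prog :=
  forLoop 7 (num 6)
    (.ite (.realLe (.get 7 (num 7))
        (.sub (.mul (.get 5 (num 7)) (.add (scalar 9) (scalar 8)))
          (.mul (.get 6 (num 7)) (scalar 9))))
      .skip
      (.setReal 9 (.const 0)
        (.div (.sub (.get 7 (num 7)) (.mul (.get 5 (num 7)) (scalar 8)))
          (.sub (.get 5 (num 7)) (.get 6 (num 7))))))

/-- Replace `d` by the maximum of `d` and `e`. -/
def raiseProg (e : RExp) : Prog :=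
  .ite (.realLe e (scalar 8)) .skip (.setReal 8 (.const 0) e)

/-- Take account of the half-plane stored in the entries `m`. -/
def insertProg : Prog :=
  .seq (.ite (.and (.realLe (.get 5 (num 6)) (.get 6 (num 6)))
        (.realLe (.get 6 (num 6)) (.get 5 (num 6))))
      (raiseProg (.div (.get 7 (num 6)) (.get 5 (num 6)))) .skip) <|
  .seq (.ite (.and (.realLe (.get 5 (num 6)) (lit 0)) (.and (.realLe (.get 6 (num 6)) (lit 0))
        (.not (.realLe (.get 7 (num 6)) (lit 0)))))
      (.seq (.setNat 4 (.const 0) (.const 0)) (.setNat 8 (.const 0) (.const 0))) .skip) <|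
  .seq (forLoop 7 (num 6)
      (.ite (.realLe (.mul (.sub (.get 5 (num 7)) (.get 6 (num 7)))
          (.sub (.get 5 (num 6)) (.get 6 (num 6)))) (lit 0))
        (raiseProg (.div
          (.add (.mul (.get 7 (num 7)) (.sub (.get 6 (num 6)) (.get 5 (num 6))))
            (.mul (.get 7 (num 6)) (.sub (.get 5 (num 7)) (.get 6 (num 7)))))
          (.sub (.mul (.get 5 (num 7)) (.get 6 (num 6)))
            (.mul (.get 5 (num 6)) (.get 6 (num 7))))))
        .skip)) <|
  .setNat 6 (.const 0) (.add (num 6) (.const 1))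

/-- Compute the slopes and the offset of entry `s` of the deviation vector. -/
def slopesProg : Prog :=
  .seq (.setReal 11 (num 7) (lit 0)) <|
  .seq (.setReal 12 (num 7) (lit 0)) <|
  .seq (.setReal 13 (num 7) (lit 0)) <|
  .ite (.natLe (.const 1) (.get 1 (num 7)))
    (.ite (.and (.natLe (.get 3 (num 7)) (.const 0))
        (.not (.realLe (.add (scalar 9) (scalar 8)) (.mul (.get 1 (num 7)) (.get 3 (num 7))))))
      (.setReal 13 (num 7) (.get 3 (num 7)))
      (.setReal 11 (num 7) (.div (lit 1) (.get 1 (num 7)))))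
    (.ite (.and (.natLe (.get 2 (num 7)) (.const 0))
        (.not (.realLe (.mul (.get 1 (num 7)) (.get 2 (num 7))) (scalar 9))))
      (.setReal 13 (num 7) (.get 2 (num 7)))
      (.setReal 12 (num 7) (.div (lit 1) (.get 1 (num 7)))))

/-- Compute the deviation vector of `(a, a + d)` and the modified cost function. -/
def devProg : Prog :=
  forLoop 7 (num 0) <|
  .seq slopesProg <|
  .seq (.setReal 4 (num 7) (.add (.add (.mul (.get 11 (num 7)) (.add (scalar 9) (scalar 8)))
      (.mul (.get 12 (num 7)) (scalar 9))) (.get 13 (num 7)))) <|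
  .setReal 10 (num 7) (.sub (.get 0 (num 7)) (.get 4 (num 7)))

/-- The difference of the characteristic vectors of `F*` and of the answer of the oracle. -/
def diffExp : RExp := .sub (.ofNat (.get 1 (num 7))) (.ofNat (.get 5 (num 7)))

/-- Store the linearization of the answer of the oracle in the entries `m`. -/
def cutProg : Prog :=
  .seq (.setReal 5 (num 6) (lit 0)) <|
  .seq (.setReal 6 (num 6) (lit 0)) <|
  .seq (.setReal 7 (num 6) (lit 0)) <|
  forLoop 7 (num 0) <|
  .seq (.setReal 5 (num 6) (.add (.get 5 (num 6)) (.mul diffExp (.get 11 (num 7))))) <|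
  .seq (.setReal 6 (num 6) (.sub (.get 6 (num 6)) (.mul diffExp (.get 12 (num 7))))) <|
  .setReal 7 (num 6) (.add (.get 7 (num 6))
    (.mul diffExp (.sub (.get 0 (num 7)) (.get 13 (num 7)))))

/-- One oracle call. -/
def roundProg : Prog :=
  .seq solveProg <| .seq devProg <| .seq (.oracle 10 5) <| .seq cutProg <|
  .ite (.realLe (.get 7 (num 6))
      (.sub (.mul (.get 5 (num 6)) (.add (scalar 9) (scalar 8)))
        (.mul (.get 6 (num 6)) (scalar 9))))
    (.setNat 8 (.const 0) (.const 0)) insertProg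

/-- Insert the half-plane `e ≤ x * b - y * a`. -/
def boundProg (x y : ℕ) (e : RExp) : Prog :=
  .seq (.setReal 5 (num 6) (lit x)) <| .seq (.setReal 6 (num 6) (lit y)) <|
    .seq (.setReal 7 (num 6) e) insertProg

/-- Insert the half-planes that come from the bounds. -/
def boundsProg : Prog :=
  forLoop 9 (num 0) <|
  .seq (.ite (.natLe (.get 3 (num 9)) (.const 0))
    (boundProg 0 1 (.sub (lit 0) (.mul (.get 1 (num 9)) (.get 3 (num 9))))) .skip) <|
  .ite (.natLe (.get 2 (num 9)) (.const 0))
    (boundProg 1 0 (.mul (.get 1 (num 9)) (.get 2 (num 9)))) .skip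

/-- The cutting plane algorithm. -/
def mainProg : Prog :=
  .seq (.setNat 4 (.const 0) (.const 1)) <|
  -- Starting the flag at `n` skips the main loop for `n = 0`, where the bound allows no oracle
  -- call.
  .seq (.setNat 8 (.const 0) (num 0)) <|
  .seq boundsProg <|
  .loop (.natLe (.const 1) (num 8)) roundProg

/-! ### Correctness of the half-plane subroutines -/

variable {n : ℕ} {O : (Fin n → ℝ) → Finset (Fin n)} {B : Set (ℝ × ℝ)}

/-- One pass suffices from any initial `a`, because by `Good.correct` each correction keeps the
half-planes already treated. -/
lemma reaches_solveProg {σ : State}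
    (h : Good B (σ.nat 6 0) (σ.real 5) (σ.real 6) (σ.real 7) (σ.real 8 0)) :
    Reaches O solveProg σ fun τ => Agree {7} {9} σ τ ∧ ∀ i < σ.nat 6 0,
      σ.real 7 i ≤ σ.real 5 i * (τ.real 9 0 + σ.real 8 0) - σ.real 6 i * τ.real 9 0 := by
  refine (Reaches.forLoop (σ.nat 6 0) (Inv := fun i τ => Agree {7} {9} σ τ ∧ τ.nat 7 0 = i ∧
    ∀ j < i, σ.real 7 j ≤ σ.real 5 j * (τ.real 9 0 + σ.real 8 0) - σ.real 6 j * τ.real 9 0)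
    ⟨(Agree.refl _ _ σ).setN (Set.mem_singleton _) 0 0, by simp, by simp⟩ ?_ ?_).mono fun τ h => ⟨h.1, h.2.2⟩
  · rintro i τ ⟨hA, hi, -⟩
    exact ⟨hi, by simp [NExp.eval, hA.nat 6 (by simp)]⟩
  · rintro i hi τ ⟨hA, rfl, hτ⟩
    refine Reaches.ite (fun hb => .skip ⟨hA.setN (Set.mem_singleton _) _ _, by simp, fun j hj => ?_⟩)
      (fun hb => .setReal ⟨(hA.setR (Set.mem_singleton _) _ _).setN (Set.mem_singleton _) _ _, by simp, ?_⟩)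
    · simp only [BExp.Holds, RExp.eval, NExp.eval, hA.real 5 (by simp), hA.real 6 (by simp),
        hA.real 7 (by simp), hA.real 8 (by simp)] at hb
      rcases Nat.lt_succ_iff_lt_or_eq.1 hj with hj | rfl
      exacts [hτ j hj, hb]
    · simp only [BExp.Holds, RExp.eval, NExp.eval, hA.real 5 (by simp), hA.real 6 (by simp),
        hA.real 7 (by simp), hA.real 8 (by simp)] at hb
      simpa [RExp.eval, NExp.eval, hA.real 5, hA.real 6, hA.real 7, hA.real 8]
        using h.correct hi hτ hb

lemma reaches_raiseProg (σ : State) (e : RExp) :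
    Reaches O (raiseProg e) σ fun τ =>
      Agree ∅ {8} σ τ ∧ τ.real 8 0 = max (σ.real 8 0) (e.eval σ) := by
  refine .ite (fun hb => .skip ⟨.refl _ _ σ, ?_⟩)
    (fun hb => .setReal ⟨(Agree.refl _ _ σ).setR (Set.mem_singleton _) _ _, ?_⟩)
  · exact (max_eq_left hb).symm
  · have : σ.real 8 0 ≤ e.eval σ := (not_le.1 hb).le
    simp [NExp.eval, this]

lemma reaches_insertProg (hB : ∀ x ∈ B, x.1 ≤ x.2) {σ : State} {m : ℕ} (hm : σ.nat 6 0 = m)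
    (h : Good B m (σ.real 5) (σ.real 6) (σ.real 7) (σ.real 8 0))
    (hX : 0 ≤ σ.real 5 m) (hY : 0 ≤ σ.real 6 m)
    (hv : ∀ x ∈ B, σ.real 7 m ≤ σ.real 5 m * x.2 - σ.real 6 m * x.1) :
    Reaches O insertProg σ fun τ => Agree {4, 6, 7, 8} {8} σ τ ∧ τ.nat 6 0 = m + 1 ∧
      (σ.real 5 m ≤ 0 ∧ σ.real 6 m ≤ 0 ∧ B = ∅ ∧ τ.nat 4 0 = 0 ∧ τ.nat 8 0 = 0 ∨
        τ.nat 4 0 = σ.nat 4 0 ∧ τ.nat 8 0 = σ.nat 8 0 ∧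
          Good B (m + 1) (σ.real 5) (σ.real 6) (σ.real 7) (τ.real 8 0)) := by
  set X := σ.real 5 with hXdef
  set Y := σ.real 6 with hYdef
  set Γ := σ.real 7 with hΓdef
  set bad : Prop := X m ≤ 0 ∧ Y m ≤ 0 ∧ ¬ Γ m ≤ 0 with hbad
  have raise {τ : State} {e : RExp} (hA : Agree {4, 6, 7, 8} {8} σ τ) {x : ℝ} (hx : e.eval τ = x) :
      Reaches O (raiseProg e) τ fun ρ => Agree {4, 6, 7, 8} {8} σ ρ ∧ ρ.nat = τ.nat ∧
        ρ.real 8 0 = max (τ.real 8 0) x :=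
    (reaches_raiseProg τ e).mono fun ρ hρ =>
      ⟨hA.trans (hρ.1.mono (by simp) le_rfl), funext fun a => hρ.1.nat a (by simp), hx ▸ hρ.2⟩
  refine .seq (Reaches.mono (Q := fun τ => Agree {4, 6, 7, 8} {8} σ τ ∧ τ.nat = σ.nat ∧
    σ.real 8 0 ≤ τ.real 8 0 ∧ (∀ x ∈ B, τ.real 8 0 ≤ x.2 - x.1) ∧
      (X m = Y m → Γ m / X m ≤ τ.real 8 0)) ?_ ?_)
  · refine .ite (fun hb => ?_) (fun hb => .skip ?_)
    · have hXY : X m = Y m := le_antisymm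
        (by simpa [BExp.Holds, RExp.eval, NExp.eval, hm] using hb.1)
        (by simpa [BExp.Holds, RExp.eval, NExp.eval, hm] using hb.2)
      refine (raise (.refl _ _ σ) (x := Γ m / X m)
        (by simp [RExp.eval, NExp.eval, hm, X, Γ])).mono fun τ hτ => ?_
      refine ⟨hτ.1, hτ.2.1, hτ.2.2 ▸ le_max_left _ _, fun x hx => ?_, fun _ => hτ.2.2 ▸ le_max_right _ _⟩
      rw [hτ.2.2]
      exact max_le (h.le_width x hx) (diag_le_width hX hXY (hv x hx) (hB x hx))
    · refine ⟨.refl _ _ σ, rfl, le_rfl, h.le_width, fun hXY => absurd ?_ hb⟩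
      simp only [BExp.Holds, RExp.eval, NExp.eval, hm]
      exact ⟨hXY.le, hXY.ge⟩
  rintro τ ⟨hA, hnat, hd, hw, hdiag⟩
  refine .seq (Reaches.mono (Q := fun ρ => Agree {4, 6, 7, 8} {8} σ ρ ∧ ρ.nat 6 0 = m ∧
    ρ.real 8 0 = τ.real 8 0 ∧ (bad ∧ ρ.nat 4 0 = 0 ∧ ρ.nat 8 0 = 0 ∨
      ¬ bad ∧ ρ.nat 4 0 = σ.nat 4 0 ∧ ρ.nat 8 0 = σ.nat 8 0)) ?_ ?_)
  · have hiff : (BExp.and (.realLe (.get 5 (num 6)) (lit 0)) (.and (.realLe (.get 6 (num 6)) (lit 0))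
        (.not (.realLe (.get 7 (num 6)) (lit 0))))).Holds τ ↔ bad := by
      simp [BExp.Holds, RExp.eval, NExp.eval, hnat, hm, hA.real 5, hA.real 6, hA.real 7, bad, X, Y, Γ]
    refine .ite (fun hb => .seq (.setNat (.setNat ?_))) (fun hb => .skip ?_)
    · refine ⟨(hA.setN (by simp) _ _).setN (by simp) _ _, by simp [hnat, hm], by simp,
        .inl ⟨hiff.1 hb, by simp [NExp.eval], by simp [NExp.eval]⟩⟩
    · exact ⟨hA, by rw [hnat, hm], rfl, .inr ⟨fun h => hb (hiff.2 h), by rw [hnat], by rw [hnat]⟩⟩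
  clear hA hnat
  rintro ρ ⟨hA, hρm, hρd, hρ⟩
  rw [← hρd] at hd hw hdiag
  refine .seq (Reaches.mono (Reaches.forLoop m (Inv := fun i π => Agree {4, 6, 7, 8} {8} σ π ∧
    π.nat 7 0 = i ∧ π.nat 6 0 = m ∧ π.nat 4 0 = ρ.nat 4 0 ∧ π.nat 8 0 = ρ.nat 8 0 ∧
    ρ.real 8 0 ≤ π.real 8 0 ∧ (∀ x ∈ B, π.real 8 0 ≤ x.2 - x.1) ∧
    ∀ j < i, (X j - Y j) * (X m - Y m) ≤ 0 → pairBound X Y Γ j m ≤ π.real 8 0) ?_ ?_ ?_) ?_)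
  · exact ⟨hA.setN (by simp) _ _, by simp, by simp [hρm], by simp, by simp, by simp, by simpa using hw,
      by simp⟩
  · rintro i π ⟨_, hi, hm', -⟩
    exact ⟨hi, by simp [NExp.eval, hm']⟩
  · rintro i hi π ⟨hA, hπi, hπm, h4, h8, hle, hw, hp⟩
    have hiff : (BExp.realLe (.mul (.sub (.get 5 (num 7)) (.get 6 (num 7)))
          (.sub (.get 5 (num 6)) (.get 6 (num 6)))) (lit 0)).Holds π ↔
        (X i - Y i) * (X m - Y m) ≤ 0 := by
      simp [BExp.Holds, RExp.eval, NExp.eval, hπi, hπm, hA.real 5, hA.real 6, X, Y]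
    refine .ite (fun hb => ?_) (fun hb => .skip ?_)
    · refine (raise hA (x := pairBound X Y Γ i m) (by simp [RExp.eval, NExp.eval, hπi, hπm,
        hA.real 5, hA.real 6, hA.real 7, X, Y, Γ, pairBound])).mono ?_
      rintro θ ⟨hθ, hθn, hθd⟩
      refine ⟨hθ.setN (by simp) _ _, by simp [hθn, hπi], by simp [hθn, hπm], by simp [hθn, h4],
        by simp [hθn, h8], ?_, ?_, ?_⟩
      · simp [hθd, hle]
      · intro x hx
        simp only [State.setN_real, hθd]
        exact max_le (hw x hx) (pairBound_le_width (h.X_nonneg i hi) hX (h.Y_nonneg i hi) hY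
          (h.valid i hi x hx) (hv x hx) (hB x hx) (hiff.1 hb))
      · intro j hj hj'
        simp only [State.setN_real, hθd]
        rcases Nat.lt_succ_iff_lt_or_eq.1 hj with hj | rfl
        exacts [(hp j hj hj').trans (le_max_left _ _), le_max_right _ _]
    · refine ⟨hA.setN (by simp) _ _, by simp [hπi], by simp [hπm], by simp [h4], by simp [h8],
        by simpa using hle, by simpa using hw, fun j hj hj' => ?_⟩
      rcases Nat.lt_succ_iff_lt_or_eq.1 hj with hj | rfl
      exacts [hp j hj hj', absurd (hiff.2 hj') hb]
  · rintro π ⟨hA, hπi, hπm, h4, h8, hle, hw, hp⟩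
    refine .setNat ⟨hA.setN (by simp) _ _, by simp [NExp.eval, hπm], ?_⟩
    rcases hρ with ⟨hb, h4', h8'⟩ | ⟨hb, h4', h8'⟩
    -- With both coefficients zero, validity at a point of `B` would read `Γ m ≤ 0`.
    · refine .inl ⟨hb.1, hb.2.1, Set.eq_empty_of_forall_notMem fun x hx => hb.2.2 ?_, by simp [h4, h4'],
        by simp [h8, h8']⟩
      have := hv x hx
      rwa [le_antisymm hb.1 hX, le_antisymm hb.2.1 hY, zero_mul, zero_mul, sub_zero] at this
    · exact .inr ⟨by simp [h4, h4'], by simp [h8, h8'],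
        h.insert hX hY hv (hd.trans hle) hw (fun e => (hdiag e).trans hle) hb hp⟩

/-! ### Correctness of the subroutines that read the input -/

/-- The input arrays describe `I`. -/
structure HasInput (I : Problem n) (σ : State) : Prop where
  size : σ.nat 0 0 = n
  fstar : ∀ s : Fin n, σ.nat 1 s = if s ∈ I.Fstar then 1 else 0
  lower_bot : ∀ s : Fin n, σ.nat 2 s ≤ 0 ↔ I.lower s ≠ ⊥
  upper_top : ∀ s : Fin n, σ.nat 3 s ≤ 0 ↔ I.upper s ≠ ⊤
  cost : ∀ s : Fin n, σ.real 0 s = I.c s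
  weight : ∀ s : Fin n, σ.real 1 s = I.w s
  lower : ∀ s : Fin n, σ.real 2 s = (I.lower s).toReal
  upper : ∀ s : Fin n, σ.real 3 s = (I.upper s).toReal

lemma charVec_val (F : Finset (Fin n)) (s : Fin n) : charVec F s = if s ∈ F then 1 else 0 := by
  simp [charVec, Fin.val_inj]

lemma hasInput_input (I : Problem n) : HasInput I I.input := by
  constructor <;> simp [Problem.input, charVec_val, extend]

/-- The input occupies the arrays `0`–`3`, which are never overwritten. -/
lemma HasInput.of_agree {I : Problem n} {A A' : Set ℕ} {σ τ : State} (h : HasInput I σ)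
    (hA : Agree A A' σ τ) (h₁ : ∀ a ∈ A, 4 ≤ a := by simp) (h₂ : ∀ a ∈ A', 4 ≤ a := by simp) :
    HasInput I τ := by
  have e (a : ℕ) (ha : a < 4) : τ.nat a = σ.nat a := hA.nat a fun h => absurd (h₁ a h) (by omega)
  have e' (a : ℕ) (ha : a < 4) : τ.real a = σ.real a :=
    hA.real a fun h => absurd (h₂ a h) (by omega)
  constructor
  · rw [e 0 (by norm_num)]; exact h.size
  · rw [e 1 (by norm_num)]; exact h.fstar
  · rw [e 2 (by norm_num)]; exact h.lower_bot
  · rw [e 3 (by norm_num)]; exact h.upper_top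
  · rw [e' 0 (by norm_num)]; exact h.cost
  · rw [e' 1 (by norm_num)]; exact h.weight
  · rw [e' 2 (by norm_num)]; exact h.lower
  · rw [e' 3 (by norm_num)]; exact h.upper

lemma reaches_slopesProg {I : Problem n} {σ : State} (hI : HasInput I σ) (s : Fin n)
    (hs : σ.nat 7 0 = s) :
    Reaches O slopesProg σ fun τ => Agree ∅ {11, 12, 13} σ τ ∧
      τ.real 11 = Function.update (σ.real 11) s (I.slopeHigh (σ.real 9 0 + σ.real 8 0) s) ∧
      τ.real 12 = Function.update (σ.real 12) s (I.slopeLow (σ.real 9 0) s) ∧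
      τ.real 13 = Function.update (σ.real 13) s
        (I.offset (σ.real 9 0) (σ.real 9 0 + σ.real 8 0) s) := by
  refine .seq (.setReal (.seq (.setReal (.seq (.setReal ?_)))))
  simp only [NExp.eval, RExp.eval, hs, State.setR_nat, Nat.cast_zero]
  set ρ := ((σ.setR 11 s 0).setR 12 s 0).setR 13 s 0 with hρ
  have hA : Agree ∅ {11, 12, 13} σ ρ :=
    (((Agree.refl _ _ σ).setR (by simp) _ _).setR (by simp) _ _).setR (by simp) _ _
  have hIρ := hI.of_agree hA
  have hρs : ρ.nat 7 0 = s := hs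
  have h8 : ρ.real 8 = σ.real 8 := hA.real 8 (by simp)
  have h9 : ρ.real 9 = σ.real 9 := hA.real 9 (by simp)
  have h11 : ρ.real 11 = Function.update (σ.real 11) s 0 := by simp [hρ]
  have h12 : ρ.real 12 = Function.update (σ.real 12) s 0 := by simp [hρ]
  have h13 : ρ.real 13 = Function.update (σ.real 13) s 0 := by simp [hρ]
  refine .ite (fun hb => .ite (fun hc => .setReal ?_) (fun hc => .setReal ?_))
    (fun hb => .ite (fun hc => .setReal ?_) (fun hc => .setReal ?_)) <;>
  simp only [BExp.Holds, NExp.eval, RExp.eval, hρs, hIρ.fstar, hIρ.upper_top, hIρ.lower_bot,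
    hIρ.weight, hIρ.upper, hIρ.lower, h8, h9, not_le, Nat.cast_one] at hb hc ⊢
  · have hF : s ∈ I.Fstar := by by_contra h; simp [h] at hb
    have hC : I.Capped (σ.real 9 0 + σ.real 8 0) s := ⟨hF, hc⟩
    refine ⟨hA.setR (by simp) _ _, ?_, ?_, ?_⟩ <;>
    simp [h11, h12, h13, Problem.slopeHigh, Problem.slopeLow, Problem.offset, hF, hC]
  · have hF : s ∈ I.Fstar := by by_contra h; simp [h] at hb
    have hC : ¬ I.Capped (σ.real 9 0 + σ.real 8 0) s := fun h => hc h.2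
    have hC' : ¬ I.Floored (σ.real 9 0) s := fun h => h.1 hF
    refine ⟨hA.setR (by simp) _ _, ?_, ?_, ?_⟩ <;>
    simp [h11, h12, h13, Problem.slopeHigh, Problem.slopeLow, Problem.offset, hF, hC, hC']
  · have hF : s ∉ I.Fstar := by intro h; simp [h] at hb
    have hC : ¬ I.Capped (σ.real 9 0 + σ.real 8 0) s := fun h => hF h.1
    have hC' : I.Floored (σ.real 9 0) s := ⟨hF, hc⟩
    refine ⟨hA.setR (by simp) _ _, ?_, ?_, ?_⟩ <;>
    simp [h11, h12, h13, Problem.slopeHigh, Problem.slopeLow, Problem.offset, hF, hC, hC']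
  · have hF : s ∉ I.Fstar := by intro h; simp [h] at hb
    have hC : ¬ I.Capped (σ.real 9 0 + σ.real 8 0) s := fun h => hF h.1
    have hC' : ¬ I.Floored (σ.real 9 0) s := fun h => hc h.2
    refine ⟨hA.setR (by simp) _ _, ?_, ?_, ?_⟩ <;>
    simp [h11, h12, h13, Problem.slopeHigh, Problem.slopeLow, Problem.offset, hF, hC, hC']

lemma reaches_devProg {I : Problem n} {σ : State} (hI : HasInput I σ) {a b : ℝ}
    (ha : σ.real 9 0 = a) (hb : σ.real 9 0 + σ.real 8 0 = b) :
    Reaches O devProg σ fun τ => Agree {7} {4, 10, 11, 12, 13} σ τ ∧ ∀ s : Fin n,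
      τ.real 4 s = I.dev a b s ∧ τ.real 10 s = I.c s - I.dev a b s ∧
      τ.real 11 s = I.slopeHigh b s ∧ τ.real 12 s = I.slopeLow a s ∧
      τ.real 13 s = I.offset a b s := by
  subst ha hb
  refine (Reaches.forLoop n (Inv := fun i τ => Agree {7} {4, 10, 11, 12, 13} σ τ ∧
    τ.nat 7 0 = i ∧ ∀ s : Fin n, (s : ℕ) < i →
      τ.real 4 s = I.dev (σ.real 9 0) (σ.real 9 0 + σ.real 8 0) s ∧
      τ.real 10 s = I.c s - I.dev (σ.real 9 0) (σ.real 9 0 + σ.real 8 0) s ∧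
      τ.real 11 s = I.slopeHigh (σ.real 9 0 + σ.real 8 0) s ∧
      τ.real 12 s = I.slopeLow (σ.real 9 0) s ∧
      τ.real 13 s = I.offset (σ.real 9 0) (σ.real 9 0 + σ.real 8 0) s)
    ⟨(Agree.refl _ _ σ).setN (Set.mem_singleton _) 0 0, by simp, by simp⟩ ?_ ?_).mono
    fun τ h => ⟨h.1, fun s => h.2.2 s s.2⟩
  · rintro i τ ⟨hA, hi, -⟩
    exact ⟨hi, (hI.of_agree hA).size⟩
  · rintro i hi τ ⟨hA, hτi, hτ⟩
    have h8 : τ.real 8 = σ.real 8 := hA.real 8 (by simp)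
    have h9 : τ.real 9 = σ.real 9 := hA.real 9 (by simp)
    refine .seq ((reaches_slopesProg (hI.of_agree hA) ⟨i, hi⟩ hτi).mono ?_)
    rintro ρ ⟨hB, h11, h12, h13⟩
    have hAρ : Agree {7} {4, 10, 11, 12, 13} σ ρ := hA.trans (hB.mono (by simp) (by
      intro x hx; simp at hx ⊢; tauto))
    have hc := (hI.of_agree hAρ).cost ⟨i, hi⟩
    have h4 : ρ.real 4 = τ.real 4 := hB.real 4 (by simp)
    have h10 : ρ.real 10 = τ.real 10 := hB.real 10 (by simp)
    have h8' : ρ.real 8 = σ.real 8 := hAρ.real 8 (by simp)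
    have h9' : ρ.real 9 = σ.real 9 := hAρ.real 9 (by simp)
    have hρi : ρ.nat 7 0 = i := by rw [hB.nat 7 (by simp), hτi]
    rw [h8, h9] at h11 h13
    rw [h9] at h12
    refine .seq (.setReal (.setReal
      ⟨((hAρ.setR (by simp) _ _).setR (by simp) _ _).setN (Set.mem_singleton _) _ _, by simp [hρi], ?_⟩))
    intro s hs
    rcases Nat.lt_succ_iff_lt_or_eq.1 hs with hs | hs
    · have hne : (s : ℕ) ≠ i := hs.ne
      simpa [NExp.eval, RExp.eval, h4, h10, h11, h12, h13, hρi, hne] using hτ s hs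
    · obtain rfl : s = ⟨i, hi⟩ := Fin.ext hs
      simp at hc
      simp [NExp.eval, RExp.eval, h8', h9', h11, h12, h13, hρi, hc, Problem.dev]

lemma reaches_cutProg {I : Problem n} {σ : State} (hI : HasInput I σ) {a b : ℝ}
    {G : Finset (Fin n)} {m : ℕ} (hm : σ.nat 6 0 = m) (hG : σ.nat 5 = charVec G)
    (hσ : ∀ s : Fin n, σ.real 11 s = I.slopeHigh b s ∧ σ.real 12 s = I.slopeLow a s ∧
      σ.real 13 s = I.offset a b s) :
    Reaches O cutProg σ fun τ => Agree {7} {5, 6, 7} σ τ ∧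
      τ.real 5 = Function.update (σ.real 5) m (I.cutHigh b G) ∧
      τ.real 6 = Function.update (σ.real 6) m (I.cutLow a G) ∧
      τ.real 7 = Function.update (σ.real 7) m (I.cutConst a b G) := by
  -- Indexing by natural numbers lets the loop invariant speak of partial sums.
  let e : ℕ → ℝ := fun i => σ.nat 1 i - σ.nat 5 i
  have he (s : Fin n) : e s = I.diff G s := by
    simp [e, hI.fstar, hG, charVec_val, Problem.diff]
  have hX : I.cutHigh b G = ∑ i ∈ Finset.range n, e i * σ.real 11 i := by
    rw [Finset.sum_range]
    exact Finset.sum_congr rfl fun s _ => by rw [he, (hσ s).1]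
  have hY : I.cutLow a G = -∑ i ∈ Finset.range n, e i * σ.real 12 i := by
    rw [Finset.sum_range]
    exact congrArg _ (Finset.sum_congr rfl fun s _ => by rw [he, (hσ s).2.1])
  have hΓ : I.cutConst a b G = ∑ i ∈ Finset.range n, e i * (σ.real 0 i - σ.real 13 i) := by
    rw [Finset.sum_range]
    exact Finset.sum_congr rfl fun s _ => by rw [he, (hσ s).2.2, hI.cost]
  rw [hX, hY, hΓ]
  refine .seq (.setReal (.seq (.setReal (.seq (.setReal ?_)))))
  refine (Reaches.forLoop n (Inv := fun i τ => Agree {7} {5, 6, 7} σ τ ∧ τ.nat 7 0 = i ∧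
      τ.real 5 = Function.update (σ.real 5) m (∑ i ∈ Finset.range i, e i * σ.real 11 i) ∧
      τ.real 6 = Function.update (σ.real 6) m (-∑ i ∈ Finset.range i, e i * σ.real 12 i) ∧
      τ.real 7 = Function.update (σ.real 7) m
        (∑ i ∈ Finset.range i, e i * (σ.real 0 i - σ.real 13 i))) ?_ ?_ ?_).mono
    fun τ h => ⟨h.1, h.2.2⟩
  · refine ⟨((((Agree.refl _ _ σ).setR (by simp) _ _).setR (by simp) _ _).setR
      (by simp) _ _).setN (Set.mem_singleton _) _ _, by simp, ?_, ?_, ?_⟩ <;> simp [NExp.eval, RExp.eval, hm]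
  · rintro i τ ⟨hA, hi, -⟩
    exact ⟨hi, (hI.of_agree hA).size⟩
  · rintro i hi τ ⟨hA, hτi, h5, h6, h7⟩
    have hτm : τ.nat 6 0 = m := by rw [hA.nat 6 (by simp), hm]
    refine .seq (.setReal (.seq (.setReal (.setReal ⟨(((hA.setR (by simp) _ _).setR
      (by simp) _ _).setR (by simp) _ _).setN (Set.mem_singleton _) _ _, by simp [hτi], ?_, ?_, ?_⟩)))) <;>
    simp [NExp.eval, RExp.eval, hτm, hτi, h5, h6, h7, diffExp, hA.nat 1, hA.nat 5, hA.real 0,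
      hA.real 11, hA.real 12, hA.real 13, Finset.sum_range_succ, e]
    ring_nf

/-- `(a, b)` lies in all stored half-planes. -/
def State.Sat (σ : State) (a b : ℝ) : Prop :=
  ∀ i < σ.nat 6 0, σ.real 7 i ≤ σ.real 5 i * b - σ.real 6 i * a

/-- The stored half-planes and the number `d` satisfy `Good`. -/
def State.IsGood (σ : State) (B : Set (ℝ × ℝ)) : Prop :=
  Good B (σ.nat 6 0) (σ.real 5) (σ.real 6) (σ.real 7) (σ.real 8 0)

/-- A positive coefficient excludes the degenerate outcome, so the bounds alone never lead to the
answer infeasible. The expression `e` is evaluated after the coefficients are stored, hence the form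
of `he`. -/
lemma reaches_boundProg (hB : ∀ x ∈ B, x.1 ≤ x.2) {σ : State} (hσ : σ.IsGood B) {x y : ℕ}
    {e : RExp} {γ : ℝ} (he : ∀ ρ, Agree ∅ {5, 6, 7} σ ρ → e.eval ρ = γ) (hxy : 0 < x ∨ 0 < y)
    (hv : ∀ z ∈ B, γ ≤ x * z.2 - y * z.1) :
    Reaches O (boundProg x y e) σ fun τ => Agree {4, 6, 7, 8} {5, 6, 7, 8} σ τ ∧
      τ.nat 4 0 = σ.nat 4 0 ∧ τ.nat 8 0 = σ.nat 8 0 ∧ τ.IsGood B ∧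
      ∀ a b, τ.Sat a b → σ.Sat a b ∧ γ ≤ x * b - y * a := by
  refine .seq (.setReal (.seq (.setReal (.seq (.setReal ?_)))))
  rw [he _ (((Agree.refl _ _ σ).setR (by simp) _ _).setR (by simp) _ _)]
  simp only [NExp.eval, RExp.eval, State.setR_nat]
  set m := σ.nat 6 0 with hm
  set ρ := ((σ.setR 5 m x).setR 6 m y).setR 7 m γ with hρ
  have hA : Agree {4, 6, 7, 8} {5, 6, 7, 8} σ ρ :=
    (((Agree.refl _ _ σ).setR (by simp) _ _).setR (by simp) _ _).setR (by simp) _ _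
  have h5 : ρ.real 5 = Function.update (σ.real 5) m x := by simp [hρ]
  have h6 : ρ.real 6 = Function.update (σ.real 6) m y := by simp [hρ]
  have h7 : ρ.real 7 = Function.update (σ.real 7) m γ := by simp [hρ]
  have h8 : ρ.real 8 = σ.real 8 := by simp [hρ]
  have e5 : ∀ i < m, ρ.real 5 i = σ.real 5 i := fun i hi => by simp [h5, hi.ne]
  have e6 : ∀ i < m, ρ.real 6 i = σ.real 6 i := fun i hi => by simp [h6, hi.ne]
  have e7 : ∀ i < m, ρ.real 7 i = σ.real 7 i := fun i hi => by simp [h7, hi.ne]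
  refine (reaches_insertProg hB (σ := ρ) (m := m) rfl (by rw [h8]; exact hσ.congr e5 e6 e7)
    (by simp [h5]) (by simp [h6]) (by simpa [h5, h6, h7] using hv)).mono ?_
  rintro τ ⟨hτ, hτm, ⟨hx, hy, -⟩ | ⟨h4, h8', hg⟩⟩
  · simp only [h5, h6, Function.update_self, Nat.cast_nonpos] at hx hy
    omega
  · have r5 : τ.real 5 = ρ.real 5 := hτ.real 5 (by simp)
    have r6 : τ.real 6 = ρ.real 6 := hτ.real 6 (by simp)
    have r7 : τ.real 7 = ρ.real 7 := hτ.real 7 (by simp)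
    refine ⟨hA.trans (hτ.mono le_rfl (by simp)), h4, h8', ?_, fun a b h => ⟨fun i hi => ?_, ?_⟩⟩
    · rw [State.IsGood, hτm, r5, r6, r7]; exact hg
    · have := h i (by rw [hτm]; exact hi.trans (Nat.lt_succ_self m))
      rwa [r5, r6, r7, e5 i hi, e6 i hi, e7 i hi] at this
    · have := h m (by rw [hτm]; exact Nat.lt_succ_self m)
      simpa [r5, r6, r7, h5, h6, h7] using this

lemma reaches_boundsProg [NeZero n] {I : Problem n} {σ : State} (hI : HasInput I σ)
    (hm : σ.nat 6 0 = 0) (hd : σ.real 8 0 = 0) :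
    Reaches O boundsProg σ fun τ => HasInput I τ ∧ τ.calls = σ.calls ∧
      τ.nat 4 0 = σ.nat 4 0 ∧ τ.nat 8 0 = σ.nat 8 0 ∧ τ.IsGood I.brackets ∧
      ∀ a b, τ.Sat a b → ∀ s, I.Compatible a b s := by
  have hB : ∀ x ∈ I.brackets, x.1 ≤ x.2 := fun x => I.le_of_mem_brackets
  refine (Reaches.forLoop n (Inv := fun i τ => Agree {4, 6, 7, 8, 9} {5, 6, 7, 8} σ τ ∧
    τ.nat 9 0 = i ∧ τ.nat 4 0 = σ.nat 4 0 ∧ τ.nat 8 0 = σ.nat 8 0 ∧ τ.IsGood I.brackets ∧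
      ∀ a b, τ.Sat a b → ∀ s : Fin n, (s : ℕ) < i → I.Compatible a b s) ?_ ?_ ?_).mono ?_
  · refine ⟨(Agree.refl _ _ σ).setN (by simp) _ _, by simp, by simp, by simp, ?_, by simp⟩
    rw [State.IsGood]
    simp only [State.setN_real, hd]
    rw [State.setN_nat_ne _ _ _ (by norm_num), hm]
    -- Without half-planes, `d = 0` is a lower bound because `a ≤ b` on `brackets`.
    exact ⟨by simp, by simp, by simp, le_rfl, fun x hx => sub_nonneg.2 (hB x hx), by simp, by simp⟩
  · rintro i τ ⟨hA, hi, -⟩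
    exact ⟨hi, (hI.of_agree hA).size⟩
  · rintro i hi τ ⟨hA, hτi, h4, h8, hg, hc⟩
    have hIτ := hI.of_agree hA
    let s : Fin n := ⟨i, hi⟩
    have sub : ({4, 6, 7, 8} : Set ℕ) ⊆ {4, 6, 7, 8, 9} := by intro x; simp; tauto
    refine .seq (Reaches.mono (Q := fun ρ => Agree {4, 6, 7, 8, 9} {5, 6, 7, 8} σ ρ ∧
      ρ.nat 9 0 = i ∧ ρ.nat 4 0 = σ.nat 4 0 ∧ ρ.nat 8 0 = σ.nat 8 0 ∧ ρ.IsGood I.brackets ∧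
      ∀ a b, ρ.Sat a b → τ.Sat a b ∧ (I.upper s ≠ ⊤ → a ≤ I.w s * (I.upper s).toReal)) ?_ ?_)
    · refine .ite (fun hb => ?_) (fun hb => .skip ?_)
      · have hs : I.upper s ≠ ⊤ := by
          simp only [BExp.Holds, NExp.eval, hτi] at hb
          exact (hIτ.upper_top s).1 hb
        refine (reaches_boundProg hB hg (γ := -(I.w s * (I.upper s).toReal)) ?_ (by simp) ?_).mono ?_
        · intro ρ hρ
          simp [RExp.eval, NExp.eval, hρ.nat 9, hτi, hρ.real 1, hρ.real 3, ← hIτ.weight, ← hIτ.upper,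
            s]
        · intro z hz
          have := I.valid_upper hz hs
          push_cast; linarith
        · rintro ρ ⟨hρ, h4', h8', hg', h⟩
          refine ⟨hA.trans (hρ.mono sub le_rfl), by rw [hρ.nat 9 (by simp), hτi], h4'.trans h4,
            h8'.trans h8, hg', fun a b hab => ⟨(h a b hab).1, fun _ => ?_⟩⟩
          have := (h a b hab).2
          push_cast at this; linarith
      · refine ⟨hA, hτi, h4, h8, hg, fun a b hab => ⟨hab, fun hs => absurd ?_ hb⟩⟩
        simp only [BExp.Holds, NExp.eval, hτi]
        exact (hIτ.upper_top s).2 hs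
    rintro ρ ⟨hAρ, hρi, h4, h8, hg, hρ⟩
    have hIρ := hI.of_agree hAρ
    have split (a b : ℝ) (hab : ρ.Sat a b)
        (hl : I.lower s ≠ ⊥ → I.w s * (I.lower s).toReal ≤ b) (t : Fin n) (ht : (t : ℕ) < i + 1) :
        I.Compatible a b t := by
      rcases Nat.lt_succ_iff_lt_or_eq.1 ht with ht | ht
      · exact hc a b (hρ a b hab).1 t ht
      · obtain rfl : t = s := Fin.ext ht
        exact ⟨(hρ a b hab).2, hl⟩
    refine .ite (fun hb => ?_) (fun hb => .skip ?_)
    · have hs : I.lower s ≠ ⊥ := by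
        simp only [BExp.Holds, NExp.eval, hρi] at hb
        exact (hIρ.lower_bot s).1 hb
      refine (reaches_boundProg hB hg (γ := I.w s * (I.lower s).toReal) ?_ (by simp) ?_).mono ?_
      · intro π hπ
        simp [RExp.eval, NExp.eval, hπ.nat 9, hρi, hπ.real 1, hπ.real 2, ← hIρ.weight, ← hIρ.lower, s]
      · intro z hz
        have := I.valid_lower hz hs
        push_cast; linarith
      · rintro π ⟨hπ, h4', h8', hg', h⟩
        refine ⟨(hAρ.trans (hπ.mono sub le_rfl)).setN (by simp) _ _,
          by simp [hπ.nat 9 (by simp), hρi], by simp [h4', h4], by simp [h8', h8], hg',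
          fun a b hab => split a b (h a b hab).1 fun _ => ?_⟩
        have := (h a b hab).2
        push_cast at this; linarith
    · refine ⟨hAρ.setN (by simp) _ _, by simp [hρi], by simp [h4], by simp [h8], hg,
        fun a b hab => split a b hab fun hs => absurd ?_ hb⟩
      simp only [BExp.Holds, NExp.eval, hρi]
      exact (hIρ.lower_bot s).2 hs
  · rintro τ ⟨hA, -, h4, h8, hg, hc⟩
    exact ⟨hI.of_agree hA, hA.calls, h4, h8, hg, fun a b h s => hc a b h s s.2⟩

/-! ### The main loop -/

/-- Invariant of the main loop before it has found the result. -/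
structure Running (I : Problem n) (σ : State) : Prop where
  input : HasInput I σ
  feasible : σ.nat 4 0 ≠ 0
  active : σ.nat 8 0 ≠ 0
  good : σ.IsGood I.brackets
  compatible : ∀ a b, σ.Sat a b → ∀ s, I.Compatible a b s
  recorded : ∃ K ⊆ I.keys, I.Recorded (σ.nat 6 0) (σ.real 5) (σ.real 6) (σ.real 7) K ∧
    σ.calls = K.card

/-- The main loop has found the result. -/
structure Finished (I : Problem n) (σ : State) : Prop where
  inactive : σ.nat 8 0 = 0
  calls_le : σ.calls ≤ I.keys.card + 1
  result : σ.nat 4 0 ≠ 0 ∧ I.IsOptimal (σ.output n) ∨ σ.nat 4 0 = 0 ∧ ¬ ∃ p, I.IsFeasible p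

lemma Running.calls_le {I : Problem n} {σ : State} (h : Running I σ) : σ.calls ≤ I.keys.card := by
  obtain ⟨K, hK, -, hc⟩ := h.recorded
  exact hc ▸ Finset.card_le_card hK

lemma reaches_roundProg [NeZero n] {I : Problem n} (hO : IsOracle I.feas O) {σ : State}
    (hσ : Running I σ) :
    Reaches O roundProg σ fun τ => (Running I τ ∨ Finished I τ) ∧ τ.calls = σ.calls + 1 := by
  have hB : ∀ x ∈ I.brackets, x.1 ≤ x.2 := fun x => I.le_of_mem_brackets
  obtain ⟨K, hKsub, hK, hcalls⟩ := hσ.recorded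
  set m := σ.nat 6 0 with hm
  set d := σ.real 8 0 with hd
  refine .seq ((reaches_solveProg hσ.good).mono ?_)
  rintro τ₁ ⟨hA₁, hsat⟩
  set a := τ₁.real 9 0 with ha
  set b := a + d with hb
  have hsat' : σ.Sat a b := hsat
  have h8₁ : τ₁.real 8 0 = d := by rw [hA₁.real 8 (by simp)]
  have hI₁ := hσ.input.of_agree hA₁
  refine .seq ((reaches_devProg hI₁ rfl rfl).mono ?_)
  rw [← ha, h8₁, ← hb]
  rintro τ₂ ⟨hA₂, hdev⟩
  have hI₂ := hI₁.of_agree hA₂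
  refine .seq (.oracle ?_)
  have hcost : (fun s : Fin n => τ₂.real 10 s) = fun s => I.c s - I.dev a b s :=
    funext fun s => (hdev s).2.1
  rw [hcost]
  set G := O (fun s => I.c s - I.dev a b s) with hGdef
  have hG : IsMinCost I.feas (fun s => I.c s - I.dev a b s) G := hO _
  set τ₃ : State := ⟨Function.update τ₂.nat 5 (charVec G), τ₂.real, τ₂.calls + 1⟩ with hτ₃
  have nat₃ (k : ℕ) (hk : k ≠ 5) : τ₃.nat k = τ₂.nat k := by simp [hτ₃, hk]
  have hI₃ : HasInput I τ₃ := by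
    have e0 := nat₃ 0 (by norm_num)
    have e1 := nat₃ 1 (by norm_num)
    have e2 := nat₃ 2 (by norm_num)
    have e3 := nat₃ 3 (by norm_num)
    exact ⟨e0 ▸ hI₂.size, e1 ▸ hI₂.fstar, e2 ▸ hI₂.lower_bot, e3 ▸ hI₂.upper_top, hI₂.cost,
      hI₂.weight, hI₂.lower, hI₂.upper⟩
  have n₃ (k : ℕ) (h5 : k ≠ 5) (h7 : k ≠ 7) : τ₃.nat k = σ.nat k := by
    rw [nat₃ k h5, hA₂.nat k (by simpa using h7), hA₁.nat k (by simpa using h7)]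
  have r₃ (k : ℕ) (h : k ∉ ({4, 9, 10, 11, 12, 13} : Set ℕ)) : τ₃.real k = σ.real k := by
    simp only [Set.mem_insert_iff, Set.mem_singleton_iff, not_or] at h
    change τ₂.real k = _
    rw [hA₂.real k (by simp; tauto), hA₁.real k (by simp; tauto)]
  have c₃ : τ₃.calls = σ.calls + 1 := by
    change τ₂.calls + 1 = _
    rw [hA₂.calls, hA₁.calls]
  have h9₃ : τ₃.real 9 0 = a := by
    change τ₂.real 9 0 = _
    rw [hA₂.real 9 (by simp)]
  refine .seq ((reaches_cutProg (m := m) hI₃ (by rw [n₃ 6 (by norm_num) (by norm_num)])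
    (G := G) (a := a) (b := b) (by simp [hτ₃]) fun s => (hdev s).2.2).mono ?_)
  rintro τ₄ ⟨hA₄, h5, h6, h7⟩
  rw [r₃ 5 (by simp)] at h5
  rw [r₃ 6 (by simp)] at h6
  rw [r₃ 7 (by simp)] at h7
  have hI₄ := hI₃.of_agree hA₄
  have n₄ (k : ℕ) (h5 : k ≠ 5) (h7 : k ≠ 7) : τ₄.nat k = σ.nat k := by
    rw [hA₄.nat k (by simpa using h7), n₃ k h5 h7]
  have m₄ : τ₄.nat 6 0 = m := by rw [n₄ 6 (by norm_num) (by norm_num)]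
  have h8₄ : τ₄.real 8 0 = d := by rw [hA₄.real 8 (by simp), r₃ 8 (by simp)]
  have h9₄ : τ₄.real 9 0 = a := by rw [hA₄.real 9 (by simp), h9₃]
  have c₄ : τ₄.calls = σ.calls + 1 := by rw [hA₄.calls, c₃]
  have hiff : (BExp.realLe (.get 7 (num 6))
      (.sub (.mul (.get 5 (num 6)) (.add (scalar 9) (scalar 8)))
        (.mul (.get 6 (num 6)) (scalar 9)))).Holds τ₄ ↔
      I.cutConst a b G ≤ I.cutHigh b G * b - I.cutLow a G * a := by
    simp [BExp.Holds, RExp.eval, NExp.eval, m₄, h5, h6, h7, h8₄, h9₄, hb]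
  -- A satisfied cut ends the loop with `dev a b`, optimal since `b - a = d`; a violated one is
  -- inserted.
  refine .ite (fun hcut => .setNat ⟨.inr ⟨?_, ?_, .inl ⟨?_, ?_⟩⟩, c₄⟩) (fun hcut => ?_)
  · simp [NExp.eval]
  · change τ₄.calls ≤ _
    rw [c₄]; exact Nat.succ_le_succ hσ.calls_le
  · simpa [n₄ 4] using hσ.feasible
  · have hout : (τ₄.setN 8 (NExp.eval τ₄ (.const 0)) (NExp.eval τ₄ (.const 0))).output n =
        I.dev a b := by
      funext s
      change τ₄.real 4 s = _
      rw [hA₄.real 4 (by simp)]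
      exact (hdev s).1
    rw [hout]
    refine I.isOptimal_dev ?_ (hσ.compatible a b hsat') hG (hiff.1 hcut) fun x hx => ?_
    · have := hσ.good.nonneg
      linarith
    · have := hσ.good.le_width x hx
      linarith
  · have e5 : ∀ i < m, τ₄.real 5 i = σ.real 5 i := fun i hi => by simp [h5, hi.ne]
    have e6 : ∀ i < m, τ₄.real 6 i = σ.real 6 i := fun i hi => by simp [h6, hi.ne]
    have e7 : ∀ i < m, τ₄.real 7 i = σ.real 7 i := fun i hi => by simp [h7, hi.ne]
    have hx0 : 0 ≤ I.cutHigh b G := by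
      obtain ⟨x, hx, -⟩ := I.exists_cutHigh_eq b G
      rw [hx]; positivity
    have hy0 : 0 ≤ I.cutLow a G := by
      obtain ⟨x, hx, -⟩ := I.exists_cutLow_eq a G
      rw [hx]; positivity
    refine (reaches_insertProg hB m₄ (by rw [h8₄]; exact hσ.good.congr e5 e6 e7)
      (by simpa [h5] using hx0) (by simpa [h6] using hy0)
      (by simpa [h5, h6, h7] using fun x y hx => I.valid_cut hx a b hG.1)).mono ?_
    rintro τ ⟨hA, hτm, h⟩
    have cτ : τ.calls = σ.calls + 1 := by rw [hA.calls, c₄]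
    refine ⟨?_, cτ⟩
    rcases h with ⟨-, -, hempty, h4, h8⟩ | ⟨h4, h8, hgood⟩
    · refine .inr ⟨h8, ?_, .inr ⟨h4, ?_⟩⟩
      · rw [cτ]; exact Nat.succ_le_succ hσ.calls_le
      · rintro ⟨p, hp⟩
        have := hp.mem_brackets
        simp [hempty] at this
    · left
      have r5 : τ.real 5 = τ₄.real 5 := hA.real 5 (by simp)
      have r6 : τ.real 6 = τ₄.real 6 := hA.real 6 (by simp)
      have r7 : τ.real 7 = τ₄.real 7 := hA.real 7 (by simp)
      refine ⟨hI₄.of_agree hA, ?_, ?_, ?_, ?_, insert (I.key a b G) K, ?_, ?_, ?_⟩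
      · rw [h4, n₄ 4 (by norm_num) (by norm_num)]; exact hσ.feasible
      · rw [h8, n₄ 8 (by norm_num) (by norm_num)]; exact hσ.active
      · rw [State.IsGood, hτm, r5, r6, r7]; exact hgood
      · refine fun a' b' h => hσ.compatible a' b' fun i hi => ?_
        have := h i (by rw [hτm]; exact hi.trans (Nat.lt_succ_self m))
        rwa [r5, r6, r7, e5 i hi, e6 i hi, e7 i hi] at this
      · exact Finset.insert_subset (I.key_mem_keys a b G) hKsub
      · rw [hτm, r5, r6, r7]
        intro k hk
        rcases Finset.mem_insert.1 hk with rfl | hk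
        · exact ⟨m, Nat.lt_succ_self m, a, b, G, hG, rfl, by simp [h5], by simp [h6], by simp [h7]⟩
        · obtain ⟨i, hi, a', b', G', h1, h2, h3, h4, h5⟩ := hK k hk
          exact ⟨i, hi.trans (Nat.lt_succ_self m), a', b', G', h1, h2, by rw [e5 i hi, h3],
            by rw [e6 i hi, h4], by rw [e7 i hi, h5]⟩
      -- The key of the violated cut is new, so `K` grows by one with each call.
      · rw [Finset.card_insert_of_notMem
          (I.key_notMem hK hsat' hG.1 fun h => hcut (hiff.2 h)), cτ, hcalls]

lemma reaches_mainProg [NeZero n] {I : Problem n} (hO : IsOracle I.feas O) :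
    Reaches O mainProg I.input (Finished I) := by
  refine .seq (.setNat (.seq (.setNat (.seq ?_))))
  simp only [NExp.eval]
  set σ := (I.input.setN 4 0 1).setN 8 0 ((I.input.setN 4 0 1).nat 0 0) with hσ
  have hA : Agree {4, 8} ∅ I.input σ :=
    ((Agree.refl _ _ I.input).setN (by simp) _ _).setN (by simp) _ _
  have hI : HasInput I σ := (hasInput_input I).of_agree hA
  refine (reaches_boundsProg hI (by rw [hA.nat 6 (by simp)]; rfl)
    (by rw [hA.real 8 (by simp)]; rfl)).mono ?_
  rintro τ ⟨hIτ, hc, h4, h8, hg, hcomp⟩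
  have hrun : Running I τ := by
    refine ⟨hIτ, by simp [h4, hσ], ?_, hg, hcomp, ∅, by simp, by simp [Problem.Recorded], ?_⟩
    · rw [h8, hσ]
      simpa [(hasInput_input I).size] using NeZero.ne n
    · rw [hc, hA.calls]; rfl
  -- Each round makes one call, and `Running` bounds the calls by the number of keys, so the variant
  -- decreases.
  refine (Reaches.loop (Q := fun τ => Running I τ ∨ Finished I τ)
    (fun τ => I.keys.card + 1 - τ.calls) (.inl hrun) ?_).mono ?_
  · rintro ρ (hρ | hρ) hb
    · refine (reaches_roundProg hO hρ).mono fun π hπ => ⟨hπ.1, ?_⟩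
      have h1 := hρ.calls_le
      have h2 := hπ.2
      omega
    · simp [BExp.Holds, NExp.eval, hρ.inactive] at hb
  · rintro ρ ⟨hρ | hρ, hb⟩
    · exact absurd (Nat.one_le_iff_ne_zero.2 hρ.active) hb
    · exact hρ

/-- On the empty ground set the main loop is not entered. -/
lemma reaches_mainProg_zero (O : (Fin 0 → ℝ) → Finset (Fin 0)) (I : Problem 0) :
    Reaches O mainProg I.input fun τ => τ.calls = 0 ∧ τ.nat 4 0 = 1 := by
  refine .seq (.setNat (.seq (.setNat (.seq ?_))))
  refine (Reaches.forLoop 0 (Inv := fun i τ => τ.calls = 0 ∧ τ.nat 4 0 = 1 ∧ τ.nat 8 0 = 0 ∧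
    τ.nat 9 0 = i ∧ τ.nat 0 0 = 0) ?_ ?_ ?_).mono ?_
  · simp [NExp.eval, Problem.input, State.setN]
  · rintro i τ ⟨-, -, -, h9, h0⟩
    exact ⟨h9, h0⟩
  · simp
  · rintro τ ⟨hc, h4, h8, -⟩
    refine ((Reaches.loop (Q := fun ρ => ρ.calls = 0 ∧ ρ.nat 4 0 = 1 ∧ ρ.nat 8 0 = 0) (fun _ => 0)
      ⟨hc, h4, h8⟩ ?_).mono fun ρ h => ⟨h.1.1, h.1.2.1⟩)
    rintro ρ ⟨-, -, h⟩ hb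
    simp [BExp.Holds, NExp.eval, h] at hb

end

end InvSpan

theorem mainTheorem2 :
    ∃ (P : InvSpan.Prog) (C : ℝ), ∀ (n : ℕ) (I : InvSpan.Problem n)
      (O : (Fin n → ℝ) → Finset (Fin n)), InvSpan.IsOracle I.feas O →
      ∃ σ : InvSpan.State, InvSpan.Exec O P I.input σ ∧
        (σ.calls : ℝ) ≤ C * ((n : ℝ) ^ 2 * I.invNorm ^ 6) ∧
        ((∃ p, I.IsFeasible p) → ¬ σ.SaysInfeasible ∧ I.IsOptimal (σ.output n)) ∧
        ((¬ ∃ p, I.IsFeasible p) → σ.SaysInfeasible) := by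
  refine ⟨InvSpan.mainProg, 17, fun n I O hO => ?_⟩
  -- For `n = 0` the bound on the calls is `0`, and the unique vector is optimal.
  rcases Nat.eq_zero_or_pos n with rfl | hn
  · obtain ⟨σ, hσ, hc, h4⟩ := InvSpan.reaches_mainProg_zero O I
    have hf (p : Fin 0 → ℝ) : I.IsFeasible p :=
      ⟨⟨I.Fstar_mem, fun G _ => by rw [Subsingleton.elim G I.Fstar]⟩, fun s => s.elim0⟩
    refine ⟨σ, hσ, by simp [hc], fun _ => ⟨?_, hf _, fun q _ => ?_⟩, fun h => (h ⟨0, hf 0⟩).elim⟩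
    · rw [InvSpan.State.SaysInfeasible, h4]; exact one_ne_zero
    · rw [Subsingleton.elim q (σ.output 0)]
  · have : NeZero n := ⟨hn.ne'⟩
    obtain ⟨σ, hσ, hfin⟩ := InvSpan.reaches_mainProg (I := I) hO
    refine ⟨σ, hσ, ?_, fun hp => ?_, fun hp => ?_⟩
    · exact (Nat.cast_le.2 hfin.calls_le).trans (I.card_keys_le hn.ne')
    · rcases hfin.result with h | h
      exacts [h, absurd hp h.2]
    · rcases hfin.result with h | h
      exacts [absurd ⟨_, h.2.1⟩ hp, h.1]
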